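/- **Setting.** Let $c\ge 1$ and let $G,F$ be probability laws on $(0,\infty)$ with $\int x^{2+\varepsilon}\,dG<\infty$ and $\int x^{2+\varepsilon}\,dF<\infty$ for some $\varepsilon>0$, and $\int x\,dF< c\int x\,dG$ (that is, $\lambda/(c\mu)<1$). Let $\mathcal T^0,\mathcal T^1,\dots,\mathcal T^c$ be independent time-stationary renewal point processes on $\mathbb R$; $\mathcal T^0$ (arrivals) has inter-event law $G$, and $\mathcal T^1,\dots,\mathcal T^c$ (activity starts of servers $1,\dots,c$) have inter-event law $F$. The points of $\mathcal T^i$ are labelled increasingly by consecutive integers, $\dots<T^i_{-2}<T^i_{-1}<0<T^i_0<T^i_1<\cdots$. The gaps other than $T^i_0-T^i_{-1}$ are i.i.d. and independent of $(T^i_{-1},T^i_0)$, and the law of the counting process is invariant under time shifts. Put $A_n=T^0_{n+1}-T^0_n$. **Vacation system.** Let $X(s,t]=|\mathcal T^0\cap(s,t]|-\sum_{i=1}^c|\mathcal T^i\cap(s,t]|$ and $Q_v(t)=\sup_{s\le t}X(s,t]$. For $t\ge 0$, let $\sigma^i_u(t)$ be the number of points $x$ of $\mathcal T^i$ in $[u,u+t]$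 with $Q_v(x-)>0$. Let $D_n=\inf\{t\ge0: Q_v(T^0_n)=\sum_{i=1}^c\sigma^i_{T^0_n}(t)\}$ and $U^i(t)=\inf\{x\in\mathcal T^i:x>t\}-t$. The service time of customer $n$ is $V_n=U^{i}(T^0_n+D_n)$, where $i=i(n)$ is the server with $T^0_n+D_n\in\mathcal T^i$. Let $\mathcal S$ sort a vector in ascending order, $\mathbf 1=(1,\dots,1)$, $\mathbf e_1=(1,0,\dots,0)$, and $$W_v(T^0_n)=D_n\mathbf 1+\mathcal S\big(U^1((T^0_n+D_n)-),\dots,U^c((T^0_n+D_n)-)\big).$$ **$GI/GI/c$ queue.** For $w\in\mathbb R^c$ let $W_k(T^0_k;w)=w$ and, for $n\ge k$, $W_k(T^0_{n+1};w)=\mathcal S\big((W_k(T^0_n;w)+V_n\mathbf e_1-A_n\mathbf 1)^+\big)$. For $u\le t$ let $Z_u(t-u;z_-)=(Q_u,R_u,E_u)$ be the state at time $t$ of the first-come-first-served $c$-server queue that is empty at time $u$ and is fed with the customers $(T^0_n,V_n)$, $T^0_n>u$: $Q_u$ is the number of waiting customers, $R_u$ the ascending vector of the remaining service times of the $c$ servers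 ($0$ for an idle server), and $E_u=t-\sup\{T^0_n:T^0_n\le t\}$. **Proposition.** Almost surely the following hold simultaneously. 1. The vacation system is well defined: $Q_v(t)<\infty$ for all $t\in\mathbb R$, and for every $n\in\mathbb Z$ the set defining $D_n$ is non-empty and $T^0_n+D_n$ belongs to $\mathcal T^i$ for exactly one $i\in\{1,\dots,c\}$. 2. For every $n\in\mathbb Z$ and every $t\in\mathbb R$ the limits $$W(n)=\lim_{k\to-\infty}W_k(T^0_n;0),\qquad Z(t)=(Q(t),R(t),E(t))=\lim_{u\to-\infty}Z_u(t-u;z_-)$$ exist in $\mathbb R^c$ and in $\mathbb N\times\mathbb R^c\times\mathbb R$, respectively. 3. They are dominated by the vacation system: $W(n)\le W_v(T^0_n)$ (entrywise) for all $n$, and $Q(t)\le Q_v(t)$ for all $t$. 4. For all $k\le n\le-1$, entrywise, $$W_k(T_n^0;0)\le W(n)\le W_k\big(T_n^0;W_v(T_k^0)\big).$$ -/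

import Mathlib

open MeasureTheory ProbabilityTheory Filter Topology

/-! Points of a point process on the line are labelled in increasing order by consecutive
integers, so that the label `-1` is the last point before the origin and the label `0` is the
first point after the origin. -/

namespace MultiServer

noncomputable section

/-- Number of points of the sequence `x` in the set `B`. -/
def count (x : ℤ → ℝ) (B : Set ℝ) : ℕ := {n : ℤ | x n ∈ B}.ncard

/-- `T` is (a labelling of) a time-stationary renewal point process on the line, with
inter-event distribution `ν`: the origin lies between the points `-1` and `0`, all the gaps except
the one around the origin are i.i.d. with law `ν` and independent of the position of the two
points around the origin, and the law of the counting process is invariant under time shifts. -/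
structure IsStationaryRenewal {Ω : Type*} [MeasurableSpace Ω] (P : Measure Ω)
    (ν : Measure ℝ) (T : ℤ → Ω → ℝ) : Prop where
  measurable : ∀ n, Measurable (T n)
  strictMono : ∀ᵐ ω ∂P, StrictMono (fun n => T n ω)
  origin : ∀ᵐ ω ∂P, T (-1) ω < 0 ∧ 0 < T 0 ω
  gap_law : ∀ n : ℤ, n ≠ -1 → P.map (fun ω => T (n + 1) ω - T n ω) = ν
  gap_indep : iIndepFun (fun (n : {n : ℤ // n ≠ -1}) ω => T (n + 1) ω - T n ω) P
  gap_indep_origin : IndepFun (fun ω => (T (-1) ω, T 0 ω))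
    (fun ω (n : {n : ℤ // n ≠ -1}) => T (n + 1) ω - T n ω) P
  stationary : ∀ u : ℝ, IdentDistrib
    (fun ω (p : ℝ × ℝ) => count (fun n => T n ω) (Set.Ioc (p.1 + u) (p.2 + u)))
    (fun ω (p : ℝ × ℝ) => count (fun n => T n ω) (Set.Ioc p.1 p.2)) P P

/-! ### First-come-first-served `c`-server queue with arrival times `a` and service times `v` -/

/-- The sorting operator: the entries of `w` in ascending order. -/
def sortVec {c : ℕ} (w : Fin c → ℝ) : Fin c → ℝ := w ∘ Tuple.sort w

/-- The Kiefer–Wolfowitz vector after `j` arrivals, when customer `k` sees the vector `w`: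
the service time of a customer is added to the smallest entry, the time until the next arrival is
subtracted from all entries, and positive parts are taken and sorted. -/
def kwIter {c : ℕ} (a v : ℤ → ℝ) (k : ℤ) (w : Fin c → ℝ) : ℕ → Fin c → ℝ
  | 0 => w
  | j + 1 => sortVec fun i =>
      max (kwIter a v k w j i + (if (i : ℕ) = 0 then v (k + j) else 0)
        - (a (k + j + 1) - a (k + j))) 0

/-- The Kiefer–Wolfowitz vector seen by customer `n ≥ k` if customer `k` sees `w`. -/
def KW {c : ℕ} (a v : ℤ → ℝ) (k n : ℤ) (w : Fin c → ℝ) : Fin c → ℝ :=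
  kwIter a v k w (n - k).toNat

/-- Time at which customer `n` starts service in the `c`-server first-come-first-served queue fed
by the customers `N, N + 1, …` and empty before: the first time `s`, not before his arrival, at
which all previous customers have started service and fewer than `c` of them are in service. -/
def startTime (c : ℕ) (a v : ℤ → ℝ) (N n : ℤ) : ℝ :=
  sInf {s : ℝ | a n ≤ s ∧ (∀ m : Set.Ico N n, startTime c a v N m ≤ s) ∧
    {m : Set.Ico N n | startTime c a v N m ≤ s ∧ s < startTime c a v N m + v m}.encard < c}
termination_by (n - N).toNat
decreasing_by
  all_goals
    have h := m.2
    simp only [Set.mem_Ico] at h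
    omega

/-- Label of the first customer who arrives strictly after time `u`. -/
def firstAfter (a : ℤ → ℝ) (u : ℝ) : ℤ := sInf {n : ℤ | u < a n}

/-- Time at which the customer `n`, arriving after `u`, starts service in the queue that is empty
at time `u`. -/
def startFrom (c : ℕ) (a v : ℤ → ℝ) (u : ℝ) (n : ℤ) : ℝ := startTime c a v (firstAfter a u) n

/-- Number of customers waiting in queue at time `u + t`, for the queue empty at time `u`. -/
def queueFrom (c : ℕ) (a v : ℤ → ℝ) (u t : ℝ) : ℕ :=
  {n : ℤ | u < a n ∧ a n ≤ u + t ∧ u + t < startFrom c a v u n}.ncard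

/-- Vector of the remaining service times of the `c` servers at time `u + t`, in ascending order,
idle servers counting as zeros, for the queue empty at time `u`. With `j = Fin.rev i`, the entry
`i` in ascending order is the smallest `x ≥ 0` exceeded by at most `j` of the remaining service
times. -/
def remainingFrom (c : ℕ) (a v : ℤ → ℝ) (u t : ℝ) (i : Fin c) : ℝ :=
  sInf {x : ℝ | 0 ≤ x ∧
    {n : ℤ | u < a n ∧ a n ≤ u + t ∧ startFrom c a v u n ≤ u + t ∧
      x < startFrom c a v u n + v n - (u + t)}.encard ≤ ((Fin.rev i : ℕ) : ℕ∞)}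

/-- Time elapsed at time `t` since the previous arrival. -/
def age (a : ℤ → ℝ) (t : ℝ) : ℝ := t - sSup {x : ℝ | x ∈ Set.range a ∧ x ≤ t}

/-- State at time `u + t` of the queue that is empty at time `u` (initial condition
`(0, 0, age a u)`): number of waiting customers, ordered remaining service times, and time since
the previous arrival. -/
def stateFrom (c : ℕ) (a v : ℤ → ℝ) (u t : ℝ) : ℕ × (Fin c → ℝ) × ℝ :=
  (queueFrom c a v u t, remainingFrom c a v u t, age a (u + t))

/-! ### The vacation system

`τ 0` is the sequence of arrival times, and `τ i.succ` is the sequence of the epochs at which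
server `i` starts an activity (service or vacation). -/

variable {c : ℕ}

/-- Arrivals minus activity starts during `(s, t]`. -/
def netInput (τ : Fin (c + 1) → ℤ → ℝ) (s t : ℝ) : ℤ :=
  (count (τ 0) (Set.Ioc s t) : ℤ) - ∑ i : Fin c, (count (τ i.succ) (Set.Ioc s t) : ℤ)

/-- Number of customers waiting in queue at time `t` in the stationary vacation system
(right-continuous version). -/
def vacQueue (τ : Fin (c + 1) → ℤ → ℝ) (t : ℝ) : ℤ :=
  sSup ((fun s => netInput τ s t) '' Set.Iic t)

/-- Number of service initiations by server `i` during `[u, u + t]`: activities that start when the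
queue is non-empty just before. -/
def serviceStarts (τ : Fin (c + 1) → ℤ → ℝ) (i : Fin c) (u t : ℝ) : ℕ :=
  {m : ℤ | τ i.succ m ∈ Set.Icc u (u + t) ∧
    0 < Function.leftLim (vacQueue τ) (τ i.succ m)}.ncard

/-- The elapsed times `t ≥ 0` after which the number of service initiations since the arrival of
customer `n` is the position in queue of this customer upon arrival. -/
def delaySet (τ : Fin (c + 1) → ℤ → ℝ) (n : ℤ) : Set ℝ :=
  {t : ℝ | 0 ≤ t ∧ vacQueue τ (τ 0 n) = ∑ i : Fin c, (serviceStarts τ i (τ 0 n) t : ℤ)}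

/-- Delay in queue of customer `n` in the vacation system. -/
def delay (τ : Fin (c + 1) → ℤ → ℝ) (n : ℤ) : ℝ := sInf (delaySet τ n)

/-- Time from `t` until the next renewal after `t` of the sequence `x`. -/
def residual (x : ℤ → ℝ) (t : ℝ) : ℝ := sInf {y : ℝ | y ∈ Set.range x ∧ t < y} - t

/-- Service time of customer `n`: the length of the activity that starts at the instant at which
this customer leaves the queue of the vacation system. -/
def serviceTime (τ : Fin (c + 1) → ℤ → ℝ) (n : ℤ) : ℝ :=
  ∑ i : Fin c, (Set.range (τ i.succ)).indicator (residual (τ i.succ)) (τ 0 n + delay τ n)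

/-- Analogue of the Kiefer–Wolfowitz vector at the arrival of customer `n` in the vacation
system. -/
def vacKW (τ : Fin (c + 1) → ℤ → ℝ) (n : ℤ) : Fin c → ℝ :=
  fun j => delay τ n +
    sortVec (fun i : Fin c => Function.leftLim (residual (τ i.succ)) (τ 0 n + delay τ n)) j

end

end MultiServer

namespace MultiServer

/-! ### Sorting -/

section Sorting

variable {c : ℕ}

/-! The proof combines Loynes' monotone scheme with a pathwise supersolution read off from the
vacation system. The Kiefer–Wolfowitz map is monotone, so starting empty at an earlier customer can
only increase the vector seen by customer `n` (`KW_zero_antitone`). The limit then exists as soon as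
there is a finite bound, and `vacKW` provides one. The vacation queue is the reflection of `flow` at
its running minimum, so its departure counter `lastServed` is nondecreasing and jumps by one exactly
at activity starts that find a customer. Its inverse `leaveTime` therefore gives the delays. In
absolute time, `vacKW τ n` lists the next activity epoch of each server at or after `leaveTime τ n`.
Adding the service time moves the initiating server to its following epoch, and waiting until
`leaveTime τ (n + 1)` can only push epochs later. This gives `kwStep_vacKW_le`, from which
domination and the sandwich follow by monotonicity. For the continuous-time state, service starts
are arrival plus smallest Kiefer–Wolfowitz entry (`startTime_eq`), hence at most `leaveTime`. The
queue length is monotone in the starting time and bounded by `vacQueue`, so it is eventually a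
constant `q`. The remaining service times are then a continuous function of the Kiefer–Wolfowitz
vector of one fixed customer, the last who has started service. Probability enters only to show that
almost every path is an `IsStableInput`. The strong law gives local finiteness and, with the
stability condition, a finite supremum; stationarity and independence exclude common points. -/

lemma le_iff_encard_le_of_monotone {g : Fin c → ℝ} (hg : Monotone g) (i : Fin c) (x : ℝ) :
    g i ≤ x ↔ {j | x < g j}.encard ≤ ((Fin.rev i : ℕ) : ℕ∞) := by
  constructor
  · intro h
    have hsub : {j | x < g j} ⊆ ((Finset.Ioi i : Finset (Fin c)) : Set (Fin c)) := by
      intro j hj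
      simp only [Finset.coe_Ioi, Set.mem_Ioi]
      by_contra hji
      exact absurd ((hg (not_lt.mp hji)).trans h) (not_le.mpr hj)
    refine (Set.encard_le_encard hsub).trans ?_
    rw [Set.encard_coe_eq_coe_finsetCard, Fin.card_Ioi, Fin.val_rev]
    norm_cast
    omega
  · intro h
    by_contra hx
    have hsub : ((Finset.Ici i : Finset (Fin c)) : Set (Fin c)) ⊆ {j | x < g j} := by
      intro j hj
      simp only [Finset.coe_Ici, Set.mem_Ici] at hj
      exact (not_le.mp hx).trans_le (hg hj)
    have h2 := (Set.encard_le_encard hsub).trans h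
    rw [Set.encard_coe_eq_coe_finsetCard, Fin.card_Ici, Fin.val_rev] at h2
    norm_cast at h2
    omega

lemma sortVec_monotone (w : Fin c → ℝ) : Monotone (sortVec w) := Tuple.monotone_sort w

lemma encard_lt_sortVec (w : Fin c → ℝ) (x : ℝ) :
    {j | x < sortVec w j}.encard = {j | x < w j}.encard := by
  have : {j | x < sortVec w j} = (Tuple.sort w).symm '' {j | x < w j} := by
    ext j
    simp [sortVec]
  rw [this, (Tuple.sort w).symm.injective.encard_image]

/-- Order statistics are determined by the numbers of entries exceeding each level, and those
numbers ignore order. This turns comparisons of sorted vectors into comparisons of counts. -/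
lemma sortVec_le_iff (w : Fin c → ℝ) (i : Fin c) (x : ℝ) :
    sortVec w i ≤ x ↔ {j | x < w j}.encard ≤ ((Fin.rev i : ℕ) : ℕ∞) := by
  rw [le_iff_encard_le_of_monotone (sortVec_monotone w), encard_lt_sortVec]

lemma sortVec_mono {w w' : Fin c → ℝ} (h : w ≤ w') : sortVec w ≤ sortVec w' := by
  intro i
  rw [sortVec_le_iff]
  exact (Set.encard_le_encard fun j (hj : _ < _) => hj.trans_le (h j)).trans
    ((sortVec_le_iff w' i _).mp le_rfl)

lemma sortVec_comp {f : ℝ → ℝ} (hf : Monotone f) (w : Fin c → ℝ) :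
    sortVec (fun i => f (w i)) = fun i => f (sortVec w i) := by
  have := (Tuple.comp_sort_eq_comp_iff_monotone (f := fun i => f (w i))
    (σ := Tuple.sort w)).mpr (hf.comp (Tuple.monotone_sort w))
  exact this.symm

lemma sortVec_comp_perm (w : Fin c → ℝ) (σ : Equiv.Perm (Fin c)) :
    sortVec (w ∘ σ) = sortVec w :=
  Tuple.comp_perm_comp_sort_eq_comp_sort

lemma sortVec_add_const (w : Fin c → ℝ) (r : ℝ) :
    sortVec (fun i => w i + r) = fun i => sortVec w i + r :=
  sortVec_comp (f := fun x => x + r) (fun _ _ h => by simpa using h) w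

lemma const_le_sortVec {w : Fin c → ℝ} {r : ℝ} (h : ∀ i, r ≤ w i) (i : Fin c) :
    r ≤ sortVec w i := h _

/-- Sorting is monotone and commutes with adding a constant, so `x ≤ y + dist x y` survives sorting:
the map is 1-Lipschitz in the sup distance. -/
lemma continuous_sortVec : Continuous (sortVec : (Fin c → ℝ) → Fin c → ℝ) := by
  have key : ∀ x y : Fin c → ℝ, ∀ i, sortVec x i ≤ sortVec y i + dist x y := by
    intro x y i
    have h : x ≤ fun i => y i + dist x y := fun i => by
      have := (le_abs_self _).trans ((Real.dist_eq (x i) (y i)).symm.le.trans (dist_le_pi_dist x y i))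
      linarith
    have h2 := sortVec_mono h i
    rwa [sortVec_add_const] at h2
  refine LipschitzWith.continuous (K := 1) (LipschitzWith.of_dist_le_mul fun x y => ?_)
  rw [NNReal.coe_one, one_mul, dist_pi_le_iff dist_nonneg]
  intro i
  rw [Real.dist_eq, abs_le]
  have h1 := key x y i
  have h2 := key y x i
  rw [dist_comm y x] at h2
  constructor <;> linarith

end Sorting

/-! ### The Kiefer–Wolfowitz recursion -/

section KieferWolfowitz

variable {c : ℕ} (a v : ℤ → ℝ)

/-- The vector `w` after the service time `s` has been added to its entry with index `0`. -/
def addFirst (w : Fin c → ℝ) (s : ℝ) (i : Fin c) : ℝ := w i + if (i : ℕ) = 0 then s else 0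

/-- One step of the Kiefer–Wolfowitz recursion. -/
noncomputable def kwStep (n : ℤ) (w : Fin c → ℝ) : Fin c → ℝ :=
  sortVec fun i => max (addFirst w (v n) i - (a (n + 1) - a n)) 0

lemma KW_self (k : ℤ) (w : Fin c → ℝ) : KW a v k k w = w := by simp [KW, kwIter]

lemma KW_succ {k n : ℤ} (h : k ≤ n) (w : Fin c → ℝ) :
    KW a v k (n + 1) w = kwStep a v n (KW a v k n w) := by
  obtain ⟨j, rfl⟩ := Int.le.dest h
  have h1 : (k + j + 1 - k).toNat = j + 1 := by omega
  have h2 : (k + j - k).toNat = j := by omega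
  simp only [KW, h1, h2, kwIter, kwStep, addFirst]

lemma addFirst_mono {w w' : Fin c → ℝ} (h : w ≤ w') (s : ℝ) : addFirst w s ≤ addFirst w' s :=
  fun i => add_le_add_left (h i) _

lemma kwStep_mono (n : ℤ) {w w' : Fin c → ℝ} (h : w ≤ w') : kwStep a v n w ≤ kwStep a v n w' :=
  sortVec_mono fun i => max_le_max (sub_le_sub_right (addFirst_mono h _ i) _) le_rfl

lemma kwStep_nonneg (n : ℤ) (w : Fin c → ℝ) : 0 ≤ kwStep a v n w :=
  const_le_sortVec fun _ => le_max_right _ _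

lemma KW_mono {k n : ℤ} (h : k ≤ n) {w w' : Fin c → ℝ} (hw : w ≤ w') :
    KW a v k n w ≤ KW a v k n w' := by
  induction n, h using Int.leInduction with
  | base => simpa [KW_self] using hw
  | succ n h ih => rw [KW_succ a v h, KW_succ a v h]; exact kwStep_mono a v n ih

lemma KW_KW {j k n : ℤ} (hj : j ≤ k) (hk : k ≤ n) (w : Fin c → ℝ) :
    KW a v k n (KW a v j k w) = KW a v j n w := by
  induction n, hk using Int.leInduction with
  | base => rw [KW_self]
  | succ n h ih => rw [KW_succ a v h, KW_succ a v (hj.trans h), ih]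

lemma KW_nonneg {k n : ℤ} (h : k ≤ n) {w : Fin c → ℝ} (hw : 0 ≤ w) : 0 ≤ KW a v k n w := by
  induction n, h using Int.leInduction with
  | base => simpa [KW_self] using hw
  | succ n h ih => rw [KW_succ a v h]; exact kwStep_nonneg a v n _

lemma KW_monotone {k n : ℤ} (h : k ≤ n) : Monotone (KW a v k n (0 : Fin c → ℝ)) := by
  induction n, h using Int.leInduction with
  | base => rw [KW_self]; exact fun _ _ _ => le_rfl
  | succ n h ih => rw [KW_succ a v h]; exact sortVec_monotone _

/-- Loynes' monotonicity: the queue begun at `j` shows customer `k` some nonnegative vector, and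
this dominates the zero vector of the queue begun at `k`. -/
lemma KW_zero_antitone {j k n : ℤ} (hj : j ≤ k) (hk : k ≤ n) :
    KW a v k n (0 : Fin c → ℝ) ≤ KW a v j n 0 := by
  rw [← KW_KW a v hj hk]
  exact KW_mono a v hk (KW_nonneg a v hj le_rfl)

/-- Comparison principle: a supersolution of a monotone recursion dominates the solution started
from it. -/
lemma KW_le_of_kwStep_le {V : ℤ → Fin c → ℝ} (hV : ∀ n, kwStep a v n (V n) ≤ V (n + 1))
    {k n : ℤ} (h : k ≤ n) : KW a v k n (V k) ≤ V n := by
  induction n, h using Int.leInduction with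
  | base => rw [KW_self]
  | succ n h ih => rw [KW_succ a v h]; exact (kwStep_mono a v n ih).trans (hV n)

end KieferWolfowitz

/-! ### The queue started empty -/

section EmptyStart

variable {c : ℕ} [NeZero c] {a v : ℤ → ℝ} {N : ℤ}

/-- Once every predecessor is known to have started by `s`, the requirement of having started is
redundant in the count of busy servers, and the subtype can be dropped. -/
lemma startTime_eq_sInf (c : ℕ) (a v : ℤ → ℝ) (N n : ℤ) : startTime c a v N n =
    sInf {s : ℝ | a n ≤ s ∧ (∀ m ∈ Set.Ico N n, startTime c a v N m ≤ s) ∧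
      {m | m ∈ Set.Ico N n ∧ s < startTime c a v N m + v m}.encard < c} := by
  rw [startTime]
  congr 1
  ext s
  simp only [Set.mem_ofPred_eq, Subtype.forall]
  refine and_congr_right fun _ => and_congr_right fun h => ?_
  have : {m | m ∈ Set.Ico N n ∧ s < startTime c a v N m + v m} = Subtype.val ''
      {m : Set.Ico N n | startTime c a v N m ≤ s ∧ s < startTime c a v N m + v m} := by
    ext m
    simp only [Set.mem_ofPred_eq, Set.mem_image, Subtype.exists, exists_and_right, exists_eq_right]
    constructor
    · rintro ⟨hm, h2⟩
      exact ⟨⟨hm, h m hm⟩, h2⟩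
    · rintro ⟨⟨hm, -⟩, h2⟩
      exact ⟨hm, h2⟩
  rw [this, Subtype.val_injective.encard_image]

/-- The servers that are busy after `y` in the Kiefer–Wolfowitz vector correspond to the
customers who depart after `y`. -/
structure KWInvariant (c : ℕ) [NeZero c] (a v : ℤ → ℝ) (N n : ℤ) : Prop where
  encard_eq : ∀ y, a n ≤ y → (∀ m ∈ Set.Ico N n, startTime c a v N m ≤ y) →
    {i : Fin c | y < a n + KW a v N n 0 i}.encard =
      {m | m ∈ Set.Ico N n ∧ y < startTime c a v N m + v m}.encard
  start_le : ∀ m ∈ Set.Ico N n, startTime c a v N m ≤ a n + KW a v N n (0 : Fin c → ℝ) 0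

/-- By the invariant, fewer than `c` predecessors remain in service at `s` exactly when the smallest
entry has expired, so the admissible times form a closed half-line. -/
lemma KWInvariant.startTime_eq {n : ℤ} (hn : N ≤ n) (h : KWInvariant c a v N n) :
    startTime c a v N n = a n + KW a v N n (0 : Fin c → ℝ) 0 := by
  rw [startTime_eq_sInf]
  have hset : {s : ℝ | a n ≤ s ∧ (∀ m ∈ Set.Ico N n, startTime c a v N m ≤ s) ∧
      {m | m ∈ Set.Ico N n ∧ s < startTime c a v N m + v m}.encard < c} =
      Set.Ici (a n + KW a v N n (0 : Fin c → ℝ) 0) := by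
    ext s
    simp only [Set.mem_ofPred_eq, Set.mem_Ici]
    have key : {i : Fin c | s < a n + KW a v N n 0 i}.encard < c ↔
        a n + KW a v N n (0 : Fin c → ℝ) 0 ≤ s := by
      have hm : Monotone fun i : Fin c => a n + KW a v N n 0 i :=
        fun i j hij => add_le_add_right (KW_monotone a v hn hij) _
      rw [le_iff_encard_le_of_monotone hm 0 s]
      have hc : (c : ℕ∞) = ((Fin.rev (0 : Fin c) : ℕ) : ℕ∞) + 1 := by
        have := NeZero.pos c
        rw [Fin.val_rev]
        norm_cast
        simp
        omega
      rw [hc, ENat.lt_add_one_iff (by simp)]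
    constructor
    · rintro ⟨h1, h2, h3⟩
      rwa [← h.encard_eq s h1 h2, key] at h3
    · intro hs
      have h1 : a n ≤ s := le_trans (by simpa using KW_nonneg a v hn (le_refl (0 : Fin c → ℝ)) 0) hs
      have h2 : ∀ m ∈ Set.Ico N n, startTime c a v N m ≤ s := fun m hm => (h.start_le m hm).trans hs
      exact ⟨h1, h2, by rwa [← h.encard_eq s h1 h2, key]⟩
  rw [hset, csInf_Ici]

/-- Customer `n` takes the server with index `0`, which is free by time `y`. Both counts gain one
element if he departs after `y`, and neither changes otherwise. -/
lemma KWInvariant.encard_addFirst {n : ℤ} (hn : N ≤ n) (h : KWInvariant c a v N n) (y : ℝ)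
    (hy : startTime c a v N n ≤ y) :
    {i : Fin c | y < a n + addFirst (KW a v N n 0) (v n) i}.encard =
      {m | m ∈ Set.Ico N (n + 1) ∧ y < startTime c a v N m + v m}.encard := by
  have hs := h.startTime_eq hn
  have h1 : a n ≤ y :=
    le_trans (by simpa [hs] using KW_nonneg a v hn (le_refl (0 : Fin c → ℝ)) 0) hy
  have h2 : ∀ m ∈ Set.Ico N n, startTime c a v N m ≤ y :=
    fun m hm => (h.start_le m hm).trans (hs ▸ hy)
  have h3 := h.encard_eq y h1 h2
  have hnot : (0 : Fin c) ∉ {i : Fin c | y < a n + KW a v N n 0 i} := by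
    simpa [← hs] using hy
  have hnot' : n ∉ {m | m ∈ Set.Ico N n ∧ y < startTime c a v N m + v m} := by simp
  by_cases hd : y < startTime c a v N n + v n
  · have e1 : {i : Fin c | y < a n + addFirst (KW a v N n 0) (v n) i} =
        insert 0 {i : Fin c | y < a n + KW a v N n 0 i} := by
      ext i
      by_cases hi : i = 0
      · subst hi
        simp only [addFirst, Set.mem_ofPred_eq, Fin.val_zero, if_true, Set.mem_insert_iff, true_or,
          iff_true]
        linarith
      · simp [addFirst, hi]
    have e2 : {m | m ∈ Set.Ico N (n + 1) ∧ y < startTime c a v N m + v m} =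
        insert n {m | m ∈ Set.Ico N n ∧ y < startTime c a v N m + v m} := by
      ext m
      by_cases hm : m = n
      · subst hm; simp [hn, hd]
      · have : m ≤ n ↔ m < n := by omega
        simp [hm, this]
    rw [e1, e2, Set.encard_insert_of_notMem hnot, Set.encard_insert_of_notMem hnot', h3]
  · have e1 : {i : Fin c | y < a n + addFirst (KW a v N n 0) (v n) i} =
        {i : Fin c | y < a n + KW a v N n 0 i} := by
      ext i
      by_cases hi : i = 0
      · subst hi
        simp only [addFirst, Set.mem_ofPred_eq, Fin.val_zero, if_true]
        constructor <;> intro <;> linarith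
      · simp [addFirst, hi]
    have e2 : {m | m ∈ Set.Ico N (n + 1) ∧ y < startTime c a v N m + v m} =
        {m | m ∈ Set.Ico N n ∧ y < startTime c a v N m + v m} := by
      ext m
      by_cases hm : m = n
      · subst hm; simp [hd]
      · have : m ≤ n ↔ m < n := by omega
        simp [this]
    rw [e1, e2, h3]

lemma kwInvariant (hv : ∀ n, 0 ≤ v n) {n : ℤ} (hn : N ≤ n) : KWInvariant c a v N n := by
  induction n, hn using Int.leInduction with
  | base =>
    constructor
    · intro y hy _
      have e1 : {i : Fin c | y < a N + KW a v N N 0 i} = ∅ := by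
        ext i; simpa [KW_self] using hy
      simp [e1]
    · simp
  | succ n hn ih =>
    have hs := ih.startTime_eq hn
    have hmono : ∀ m ∈ Set.Ico N (n + 1), startTime c a v N m ≤ startTime c a v N n := by
      intro m hm
      rcases eq_or_ne m n with rfl | hne
      · exact le_rfl
      · have := hm.2
        exact (ih.start_le m ⟨hm.1, by omega⟩).trans hs.ge
    constructor
    · intro y hy hy2
      rw [← ih.encard_addFirst hn y (hy2 n ⟨hn, by omega⟩), KW_succ a v hn, kwStep]
      have e1 : {i : Fin c | y < a (n + 1) + sortVec (fun i =>
          max (addFirst (KW a v N n 0) (v n) i - (a (n + 1) - a n)) 0) i} =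
          {i : Fin c | y - a (n + 1) < sortVec (fun i =>
          max (addFirst (KW a v N n 0) (v n) i - (a (n + 1) - a n)) 0) i} := by
        ext i; simp [sub_lt_iff_lt_add']
      rw [e1, encard_lt_sortVec]
      -- The change of time origin cancels, and the positive part is invisible because `y` is not
      -- before the next arrival.
      congr 1
      ext i
      simp only [Set.mem_ofPred_eq, lt_max_iff]
      constructor
      · rintro (h | h) <;> linarith
      · intro h; left; linarith
    · intro m hm
      refine (hmono m hm).trans ?_
      rw [hs, KW_succ a v hn]
      -- Start times are nondecreasing: with nonnegative service times, no entry of the new vector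
      -- is below the old minimum less the elapsed time.
      have : KW a v N n (0 : Fin c → ℝ) 0 - (a (n + 1) - a n) ≤
          kwStep a v n (KW a v N n (0 : Fin c → ℝ)) 0 := by
        refine const_le_sortVec (fun i => le_max_of_le_left ?_) 0
        have h1 := KW_monotone (c := c) a v hn (Fin.zero_le i)
        have h2 : 0 ≤ if (i : ℕ) = 0 then v n else 0 := by split_ifs <;> simp [hv]
        simp only [addFirst]
        linarith
      linarith

lemma startTime_eq (hv : ∀ n, 0 ≤ v n) {n : ℤ} (hn : N ≤ n) :
    startTime c a v N n = a n + KW a v N n (0 : Fin c → ℝ) 0 :=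
  (kwInvariant hv hn).startTime_eq hn

lemma startTime_mono (hv : ∀ n, 0 ≤ v n) {m n : ℤ} (hm : N ≤ m) (hmn : m ≤ n) :
    startTime c a v N m ≤ startTime c a v N n := by
  rcases hmn.eq_or_lt with rfl | h
  · exact le_rfl
  · rw [startTime_eq hv (hm.trans hmn)]
    exact (kwInvariant hv (hm.trans hmn)).start_le m ⟨hm, h⟩

end EmptyStart

/-! ### Locally finite sequences of points -/

section Points

/-- The points are strictly increasing and accumulate only at infinity, in both directions. -/
structure IsLocallyFinite (x : ℤ → ℝ) : Prop where
  strictMono : StrictMono x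
  tendsto_atTop : Tendsto x atTop atTop
  tendsto_atBot : Tendsto x atBot atBot

/-- Label of the last point in `(-∞, t]`. -/
noncomputable def lastLE (x : ℤ → ℝ) (t : ℝ) : ℤ := sSup {n | x n ≤ t}

/-- Label of the last point in `(-∞, t)`. -/
noncomputable def lastLT (x : ℤ → ℝ) (t : ℝ) : ℤ := sSup {n | x n < t}

lemma mem_iff_le_csSup {S : Set ℤ} (hne : S.Nonempty) (hb : BddAbove S)
    (hd : ∀ m n, m ≤ n → n ∈ S → m ∈ S) (n : ℤ) : n ∈ S ↔ n ≤ sSup S :=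
  ⟨fun h => le_csSup hb h, fun h => hd n _ h (Int.csSup_mem hne hb)⟩

variable {x : ℤ → ℝ} (hx : IsLocallyFinite x)
include hx

lemma IsLocallyFinite.le_lastLE_iff {n : ℤ} {t : ℝ} : n ≤ lastLE x t ↔ x n ≤ t := by
  refine (mem_iff_le_csSup (S := {n | x n ≤ t}) ?_ ?_ ?_ n).symm
  · exact (hx.tendsto_atBot.eventually (eventually_le_atBot t)).exists
  · obtain ⟨N, hN⟩ := (hx.tendsto_atTop.eventually (eventually_gt_atTop t)).exists
    exact ⟨N, fun n hn => (hx.strictMono.lt_iff_lt.mp (lt_of_le_of_lt hn hN)).le⟩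
  · exact fun m n h hn => le_trans (hx.strictMono.monotone h) hn

lemma IsLocallyFinite.le_lastLT_iff {n : ℤ} {t : ℝ} : n ≤ lastLT x t ↔ x n < t := by
  refine (mem_iff_le_csSup (S := {n | x n < t}) ?_ ?_ ?_ n).symm
  · exact (hx.tendsto_atBot.eventually (eventually_lt_atBot t)).exists
  · obtain ⟨N, hN⟩ := (hx.tendsto_atTop.eventually (eventually_gt_atTop t)).exists
    exact ⟨N, fun n hn => (hx.strictMono.lt_iff_lt.mp (lt_trans hn hN)).le⟩
  · exact fun m n h hn => lt_of_le_of_lt (hx.strictMono.monotone h) hn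

lemma IsLocallyFinite.lastLE_lt_iff {n : ℤ} {t : ℝ} : lastLE x t < n ↔ t < x n := by
  rw [← not_le, hx.le_lastLE_iff, not_le]

lemma IsLocallyFinite.lastLT_lt_iff {n : ℤ} {t : ℝ} : lastLT x t < n ↔ t ≤ x n := by
  rw [← not_le, hx.le_lastLT_iff, not_lt]

lemma IsLocallyFinite.apply_lastLE_le (t : ℝ) : x (lastLE x t) ≤ t := hx.le_lastLE_iff.mp le_rfl

lemma IsLocallyFinite.lt_apply_lastLE (t : ℝ) : t < x (lastLE x t + 1) :=
  hx.lastLE_lt_iff.mp (lt_add_one _)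

lemma IsLocallyFinite.apply_lastLT_lt (t : ℝ) : x (lastLT x t) < t := hx.le_lastLT_iff.mp le_rfl

lemma IsLocallyFinite.le_apply_lastLT (t : ℝ) : t ≤ x (lastLT x t + 1) :=
  hx.lastLT_lt_iff.mp (lt_add_one _)

lemma IsLocallyFinite.lastLE_mono : Monotone (lastLE x) := fun s _ h =>
  hx.le_lastLE_iff.mpr ((hx.apply_lastLE_le s).trans h)

lemma IsLocallyFinite.lastLE_le_lastLT {s t : ℝ} (h : s < t) : lastLE x s ≤ lastLT x t :=
  hx.le_lastLT_iff.mpr ((hx.apply_lastLE_le s).trans_lt h)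

lemma IsLocallyFinite.lastLE_apply (n : ℤ) : lastLE x (x n) = n :=
  le_antisymm (Int.lt_add_one_iff.mp (hx.lastLE_lt_iff.mpr (hx.strictMono (lt_add_one n))))
    (hx.le_lastLE_iff.mpr le_rfl)

lemma IsLocallyFinite.lastLT_apply (n : ℤ) : lastLT x (x n) = n - 1 :=
  le_antisymm (Int.le_sub_one_iff.mpr (hx.lastLT_lt_iff.mpr le_rfl))
    (hx.le_lastLT_iff.mpr (hx.strictMono (sub_one_lt n)))

lemma IsLocallyFinite.lastLE_eq_lastLT {t : ℝ} (h : t ∉ Set.range x) :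
    lastLE x t = lastLT x t :=
  le_antisymm (hx.le_lastLT_iff.mpr (lt_of_le_of_ne (hx.apply_lastLE_le t) fun h' => h ⟨_, h'⟩))
    (hx.le_lastLE_iff.mpr (hx.apply_lastLT_lt t).le)

lemma IsLocallyFinite.lastLE_eq_lastLT_add_one {t : ℝ} (h : t ∈ Set.range x) :
    lastLE x t = lastLT x t + 1 := by
  obtain ⟨n, rfl⟩ := h
  rw [hx.lastLE_apply, hx.lastLT_apply, sub_add_cancel]

lemma IsLocallyFinite.tendsto_lastLE : Tendsto (lastLE x) atTop atTop :=
  tendsto_atTop_atTop.mpr fun n => ⟨x n, fun _ h => hx.le_lastLE_iff.mpr h⟩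

lemma IsLocallyFinite.eventually_lastLE_right (t : ℝ) :
    ∀ᶠ r in 𝓝[≥] t, lastLE x r = lastLE x t := by
  filter_upwards [Ico_mem_nhdsGE (hx.lt_apply_lastLE t)] with r hr
  exact le_antisymm (Int.lt_add_one_iff.mp (hx.lastLE_lt_iff.mpr hr.2)) (hx.lastLE_mono hr.1)

lemma IsLocallyFinite.eventually_lastLE_left (t : ℝ) :
    ∀ᶠ r in 𝓝[<] t, lastLE x r = lastLT x t := by
  filter_upwards [Ico_mem_nhdsLT (hx.apply_lastLT_lt t)] with r hr
  exact le_antisymm (hx.lastLE_le_lastLT hr.2) (hx.le_lastLE_iff.mpr hr.1)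

lemma IsLocallyFinite.count_Ioc {s t : ℝ} (h : s ≤ t) :
    (count x (Set.Ioc s t) : ℤ) = lastLE x t - lastLE x s := by
  have : {n : ℤ | x n ∈ Set.Ioc s t} =
      ((Finset.Ioc (lastLE x s) (lastLE x t) : Finset ℤ) : Set ℤ) := by
    ext n
    simp [hx.le_lastLE_iff, hx.lastLE_lt_iff]
  rw [count, this, Set.ncard_coe_finset, Int.card_Ioc,
    Int.toNat_of_nonneg (sub_nonneg.mpr (hx.lastLE_mono h))]

lemma IsLocallyFinite.residual_eq (t : ℝ) : residual x t = x (lastLE x t + 1) - t := by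
  have : IsLeast {y : ℝ | y ∈ Set.range x ∧ t < y} (x (lastLE x t + 1)) := by
    refine ⟨⟨⟨_, rfl⟩, hx.lt_apply_lastLE t⟩, ?_⟩
    rintro _ ⟨⟨n, rfl⟩, hn⟩
    exact hx.strictMono.monotone (Int.add_one_le_iff.mpr (hx.lastLE_lt_iff.mpr hn))
  rw [residual, this.csInf_eq]

lemma IsLocallyFinite.leftLim_residual (t : ℝ) :
    Function.leftLim (residual x) t = x (lastLT x t + 1) - t := by
  refine leftLim_eq_of_tendsto ?_
  have h1 : Tendsto (fun r => x (lastLT x t + 1) - r) (𝓝[<] t) (𝓝 (x (lastLT x t + 1) - t)) :=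
    tendsto_const_nhds.sub (tendsto_id.mono_left nhdsWithin_le_nhds)
  refine h1.congr' ?_
  filter_upwards [hx.eventually_lastLE_left t] with r hr
  rw [hx.residual_eq, hr]

lemma IsLocallyFinite.firstAfter_eq (u : ℝ) : firstAfter x u = lastLE x u + 1 := by
  have : IsLeast {n : ℤ | u < x n} (lastLE x u + 1) :=
    ⟨hx.lt_apply_lastLE u, fun n hn => Int.add_one_le_iff.mpr (hx.lastLE_lt_iff.mpr hn)⟩
  rw [firstAfter, this.csInf_eq]

end Points

/-! ### The vacation queue as a reflected path -/

section Reflection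

variable {c : ℕ} {τ : Fin (c + 1) → ℤ → ℝ}

/-- Locally finite point sequences without common points, for which the vacation queue is
finite. -/
structure IsStableInput (τ : Fin (c + 1) → ℤ → ℝ) : Prop where
  locallyFinite : ∀ i, IsLocallyFinite (τ i)
  disjoint : ∀ i j, i ≠ j → ∀ m n, τ i m ≠ τ j n
  bddAbove : ∀ t, BddAbove ((fun s => netInput τ s t) '' Set.Iic t)

/-- Number of activity starts up to time `t`, up to an additive constant. -/
noncomputable def activities (τ : Fin (c + 1) → ℤ → ℝ) (t : ℝ) : ℤ :=
  ∑ i : Fin c, lastLE (τ i.succ) t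

/-- The net input up to time `t`, up to an additive constant. -/
noncomputable def flow (τ : Fin (c + 1) → ℤ → ℝ) (t : ℝ) : ℤ :=
  lastLE (τ 0) t - activities τ t

/-- Running minimum of the net input. -/
noncomputable def flowMin (τ : Fin (c + 1) → ℤ → ℝ) (t : ℝ) : ℤ := sInf (flow τ '' Set.Iic t)

/-- Label of the last customer who has left the vacation queue by time `t`. -/
noncomputable def lastServed (τ : Fin (c + 1) → ℤ → ℝ) (t : ℝ) : ℤ :=
  lastLE (τ 0) t - vacQueue τ t

/-- Time at which customer `n` leaves the vacation queue. -/
noncomputable def leaveTime (τ : Fin (c + 1) → ℤ → ℝ) (n : ℤ) : ℝ :=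
  sInf {t | n ≤ lastServed τ t}

lemma netInput_eq (hτ : ∀ i, IsLocallyFinite (τ i)) {s t : ℝ} (hst : s ≤ t) :
    netInput τ s t = flow τ t - flow τ s := by
  simp only [netInput, flow, activities, fun i => (hτ i).count_Ioc hst, Finset.sum_sub_distrib]
  ring

variable (h : IsStableInput τ)
include h

lemma IsStableInput.bddBelow_flow (t : ℝ) : BddBelow (flow τ '' Set.Iic t) := by
  obtain ⟨B, hB⟩ := h.bddAbove t
  refine ⟨flow τ t - B, ?_⟩
  rintro _ ⟨s, hs, rfl⟩
  have := hB ⟨s, hs, rfl⟩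
  simp only [netInput_eq h.locallyFinite hs] at this
  linarith

lemma IsStableInput.flowMin_le {s t : ℝ} (hst : s ≤ t) : flowMin τ t ≤ flow τ s :=
  csInf_le (h.bddBelow_flow t) ⟨s, hst, rfl⟩

lemma IsStableInput.exists_flow_eq (t : ℝ) : ∃ s ≤ t, flow τ s = flowMin τ t :=
  Int.csInf_mem (Set.nonempty_Iic.image _) (h.bddBelow_flow t)

lemma IsStableInput.flowMin_anti {s t : ℝ} (hst : s ≤ t) : flowMin τ t ≤ flowMin τ s := by
  obtain ⟨r, hr, hr'⟩ := h.exists_flow_eq s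
  exact hr' ▸ h.flowMin_le (hr.trans hst)

lemma IsStableInput.vacQueue_eq (t : ℝ) : vacQueue τ t = flow τ t - flowMin τ t := by
  have : IsGreatest ((fun s => netInput τ s t) '' Set.Iic t) (flow τ t - flowMin τ t) := by
    constructor
    · obtain ⟨s, hs, hs'⟩ := h.exists_flow_eq t
      exact ⟨s, hs, by simp only [netInput_eq h.locallyFinite hs, hs']⟩
    · rintro _ ⟨s, hs, rfl⟩
      simp only [netInput_eq h.locallyFinite hs]
      linarith [h.flowMin_le hs]
  rw [vacQueue, this.csSup_eq]

lemma IsStableInput.vacQueue_nonneg (t : ℝ) : 0 ≤ vacQueue τ t := by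
  rw [h.vacQueue_eq]
  linarith [h.flowMin_le (le_refl t)]

lemma IsStableInput.lastServed_eq (t : ℝ) : lastServed τ t = activities τ t + flowMin τ t := by
  rw [lastServed, h.vacQueue_eq, flow]
  ring

lemma IsStableInput.activities_mono : Monotone (activities τ) := fun _ _ hst =>
  Finset.sum_le_sum fun i _ => (h.locallyFinite i.succ).lastLE_mono hst

/-- Let `r` attain the minimum up to `t`. If `r ≤ s`, the minimum has not dropped since `s` while
the activities have grown. If `s ≤ r`, the queue is empty at `r`, so everyone who arrived by `s` has
left by `r`. -/
lemma IsStableInput.lastServed_mono : Monotone (lastServed τ) := by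
  intro s t hst
  rw [h.lastServed_eq, h.lastServed_eq]
  obtain ⟨r, hr, hr'⟩ := h.exists_flow_eq t
  have h1 := h.activities_mono hst
  rcases le_total r s with hrs | hsr
  · have := h.flowMin_le hrs
    linarith
  · have h2 := h.flowMin_le (le_refl s)
    have h3 := (h.locallyFinite 0).lastLE_mono hsr
    have h4 := h.activities_mono hr
    simp only [flow] at hr' h2
    linarith

lemma IsStableInput.flowMin_eq_min {u t : ℝ} (hut : u < t)
    (hc : ∀ r ∈ Set.Ico u t, flow τ r = flow τ u) :
    flowMin τ t = min (flowMin τ u) (flow τ t) := by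
  refine le_antisymm (le_min (h.flowMin_anti hut.le) (h.flowMin_le le_rfl)) ?_
  obtain ⟨r, hr, hr'⟩ := h.exists_flow_eq t
  rw [← hr']
  rcases hr.eq_or_lt with rfl | hrt
  · exact min_le_right _ _
  · refine (min_le_left _ _).trans ?_
    rcases le_total r u with hru | hur
    · exact h.flowMin_le hru
    · rw [hc r ⟨hur, hrt⟩]
      exact h.flowMin_le le_rfl

lemma IsStableInput.flowMin_eq {u t : ℝ} (hut : u ≤ t)
    (hc : ∀ r ∈ Set.Icc u t, flow τ r = flow τ u) : flowMin τ t = flowMin τ u := by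
  rcases hut.eq_or_lt with rfl | hlt
  · rfl
  · rw [h.flowMin_eq_min hlt fun r hr => hc r ⟨hr.1, hr.2.le⟩, hc t ⟨hut, le_rfl⟩]
    exact min_eq_left (h.flowMin_le le_rfl)

lemma IsStableInput.lastServed_eq_of_const {u t : ℝ} (hut : u ≤ t)
    (hc : ∀ r ∈ Set.Icc u t, ∀ i, lastLE (τ i) r = lastLE (τ i) u) :
    lastServed τ t = lastServed τ u ∧ vacQueue τ t = vacQueue τ u := by
  have ha : ∀ r ∈ Set.Icc u t, activities τ r = activities τ u := fun r hr =>
    Finset.sum_congr rfl fun i _ => hc r hr i.succ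
  have hf : ∀ r ∈ Set.Icc u t, flow τ r = flow τ u := fun r hr => by
    rw [flow, flow, ha r hr, hc r hr 0]
  have hm := h.flowMin_eq hut hf
  rw [h.lastServed_eq, h.lastServed_eq, h.vacQueue_eq, h.vacQueue_eq, hm, ha t ⟨hut, le_rfl⟩,
    hf t ⟨hut, le_rfl⟩]
  exact ⟨rfl, rfl⟩

lemma IsStableInput.eventually_right (t : ℝ) :
    ∀ᶠ r in 𝓝[≥] t, lastServed τ r = lastServed τ t := by
  have h1 := eventually_all.mpr fun i => (h.locallyFinite i).eventually_lastLE_right t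
  obtain ⟨y, hy, hsub⟩ := mem_nhdsGE_iff_exists_Ico_subset.mp h1
  filter_upwards [Ico_mem_nhdsGE hy] with r hr
  exact (h.lastServed_eq_of_const hr.1 fun q hq i => hsub ⟨hq.1, hq.2.trans_lt hr.2⟩ i).1

/-- Local finiteness replaces left limits at `t` by values at an actual time `u`, with all counters
frozen on `[u, t)`; `u` can be taken after any prescribed `s < t`. -/
lemma IsStableInput.exists_left {s t : ℝ} (hst : s < t) :
    ∃ u < t, s ≤ u ∧ (∀ i, lastLE (τ i) u = lastLT (τ i) t) ∧
      (∀ r ∈ Set.Ico u t, flow τ r = flow τ u) ∧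
      Function.leftLim (vacQueue τ) t = vacQueue τ u := by
  have h1 := eventually_all.mpr fun i => (h.locallyFinite i).eventually_lastLE_left t
  obtain ⟨u, hu, hsub'⟩ :=
    mem_nhdsLT_iff_exists_Ico_subset.mp (h1.and (Ico_mem_nhdsLT hst))
  have hsu : s ≤ u := (hsub' ⟨le_rfl, hu⟩).2.1
  have hsub := fun {r} (hr : r ∈ Set.Ico u t) => (hsub' hr).1
  have hu0 := hsub ⟨le_rfl, hu⟩
  refine ⟨u, hu, hsu, hu0, fun r hr => ?_, ?_⟩
  · have hr0 := hsub hr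
    simp only [flow, activities]
    rw [hr0 0, hu0 0]
    exact congrArg _ (Finset.sum_congr rfl fun i _ => by rw [hr0 i.succ, hu0 i.succ])
  · refine leftLim_eq_of_tendsto ?_
    refine tendsto_const_nhds.congr' ?_
    filter_upwards [Ico_mem_nhdsLT hu] with r hr
    exact (h.lastServed_eq_of_const hr.1 fun q hq i =>
      (hsub ⟨hq.1, hq.2.trans_lt hr.2⟩ i).trans (hu0 i).symm).2.symm

lemma IsStableInput.not_mem_range {i j : Fin (c + 1)} (hij : i ≠ j) {t : ℝ}
    (ht : t ∈ Set.range (τ i)) : t ∉ Set.range (τ j) := by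
  rintro ⟨n, rfl⟩
  obtain ⟨m, hm⟩ := ht
  exact h.disjoint i j hij m n hm

lemma IsStableInput.lastLE_of_ne {i j : Fin (c + 1)} (hij : i ≠ j) {t : ℝ}
    (ht : t ∈ Set.range (τ i)) : lastLE (τ j) t = lastLT (τ j) t :=
  (h.locallyFinite j).lastLE_eq_lastLT (h.not_mem_range hij ht)

/-- At the start of an activity, a customer leaves the queue if there is one. -/
lemma IsStableInput.exists_left_activity {s t : ℝ} (hst : s < t) {i : Fin c}
    (ht : t ∈ Set.range (τ i.succ)) : ∃ u < t, s ≤ u ∧ Function.leftLim (vacQueue τ) t = vacQueue τ u ∧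
      lastServed τ t = lastServed τ u + if 0 < vacQueue τ u then 1 else 0 := by
  obtain ⟨u, hu, hsu, hidx, hflow, hlim⟩ := h.exists_left hst
  refine ⟨u, hu, hsu, hlim, ?_⟩
  have ha : activities τ t = activities τ u + 1 := by
    simp only [activities]
    rw [← Finset.add_sum_erase _ _ (Finset.mem_univ i), ← Finset.add_sum_erase Finset.univ
      (fun i : Fin c => lastLE (τ i.succ) u) (Finset.mem_univ i),
      (h.locallyFinite i.succ).lastLE_eq_lastLT_add_one ht, hidx i.succ]
    have : ∑ j ∈ Finset.univ.erase i, lastLE (τ j.succ) t =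
        ∑ j ∈ Finset.univ.erase i, lastLE (τ j.succ) u := by
      refine Finset.sum_congr rfl fun j hj => ?_
      rw [hidx, h.lastLE_of_ne (fun h' => (Finset.ne_of_mem_erase hj) (Fin.succ_injective _ h').symm)
        ht]
    rw [this]
    ring
  have h0 : lastLE (τ 0) t = lastLE (τ 0) u := by
    rw [hidx, h.lastLE_of_ne (Fin.succ_ne_zero i) ht]
  have hY : flow τ t = flow τ u - 1 := by
    rw [flow, flow, ha, h0]
    ring
  rw [h.lastServed_eq, h.lastServed_eq, h.vacQueue_eq, ha, h.flowMin_eq_min hu hflow, hY]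
  have := h.flowMin_le (le_refl u)
  -- The unit drop of the flow lowers the running minimum only if the queue was empty; in that case
  -- it cancels the extra activity.
  split_ifs with h1
  · rw [min_eq_left (by omega)]
    ring
  · rw [min_eq_right (by omega)]
    omega

/-- Without an activity start, no customer leaves the queue. -/
lemma IsStableInput.exists_left_of_not_mem {t : ℝ} (ht : ∀ i : Fin c, t ∉ Set.range (τ i.succ)) :
    ∃ u < t, lastServed τ t = lastServed τ u := by
  obtain ⟨u, hu, -, hidx, hflow, -⟩ := h.exists_left (sub_one_lt t)
  refine ⟨u, hu, ?_⟩
  have ha : activities τ t = activities τ u := Finset.sum_congr rfl fun i _ => by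
    rw [hidx, (h.locallyFinite i.succ).lastLE_eq_lastLT (ht i)]
  have hY : flow τ u ≤ flow τ t := by
    rw [flow, flow, ha]
    have := (h.locallyFinite 0).lastLE_mono hu.le
    linarith
  rw [h.lastServed_eq, h.lastServed_eq, ha, h.flowMin_eq_min hu hflow,
    min_eq_left ((h.flowMin_le le_rfl).trans hY)]

lemma IsStableInput.vacQueue_arrival_pos (n : ℤ) : 0 < vacQueue τ (τ 0 n) := by
  obtain ⟨u, hu, -, hidx, hflow, -⟩ := h.exists_left (sub_one_lt (τ 0 n))
  have hmem : τ 0 n ∈ Set.range (τ 0) := ⟨n, rfl⟩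
  have ha : activities τ (τ 0 n) = activities τ u := Finset.sum_congr rfl fun i _ => by
    rw [hidx, h.lastLE_of_ne (Fin.succ_ne_zero i).symm hmem]
  have h1 := h.flowMin_le hu.le
  rw [h.vacQueue_eq]
  simp only [flow] at h1 ⊢
  rw [ha, (h.locallyFinite 0).lastLE_eq_lastLT_add_one hmem, ← hidx 0]
  omega

/-- If customer `n` never left, the queue would stay positive after his arrival and the running
minimum would freeze. But `lastServed` is activities plus minimum, and the activities of a single
server already tend to infinity. -/
lemma IsStableInput.exists_le_lastServed [NeZero c] (n : ℤ) : ∃ t, n ≤ lastServed τ t := by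
  by_contra! hlt
  have hQ : ∀ t, τ 0 n ≤ t → 0 < vacQueue τ t := by
    intro t ht
    have h1 := hlt t
    have h2 := (h.locallyFinite 0).le_lastLE_iff.mpr ht
    simp only [lastServed] at h1
    omega
  have hM : ∀ t, τ 0 n ≤ t → flowMin τ (τ 0 n) ≤ flowMin τ t := by
    intro t ht
    obtain ⟨s, hs, hs'⟩ := h.exists_flow_eq t
    rcases le_total s (τ 0 n) with h1 | h1
    · rw [← hs']
      exact h.flowMin_le h1
    · have h2 := hQ s h1
      have h3 := h.flowMin_anti hs
      rw [h.vacQueue_eq] at h2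
      omega
  have hA : Tendsto (activities τ) atTop atTop := by
    have hz : ∀ s t : ℝ, s ≤ t → activities τ s +
        (lastLE (τ (Fin.succ 0)) t - lastLE (τ (Fin.succ 0)) s) ≤ activities τ t := by
      intro s t hst
      have := Finset.single_le_sum (f := fun i : Fin c => lastLE (τ i.succ) t - lastLE (τ i.succ) s)
        (fun i _ => sub_nonneg.mpr ((h.locallyFinite i.succ).lastLE_mono hst))
        (Finset.mem_univ (0 : Fin c))
      simp only [Finset.sum_sub_distrib] at this
      simp only [activities]
      linarith
    refine tendsto_atTop_mono' atTop ((eventually_ge_atTop 0).mono fun t ht => hz 0 t ht) ?_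
    refine tendsto_atTop_add_const_left _ _ ?_
    simp only [sub_eq_add_neg]
    exact tendsto_atTop_add_const_right _ _ (h.locallyFinite _).tendsto_lastLE
  obtain ⟨t, ht1, ht2⟩ := ((hA.eventually (eventually_ge_atTop
    (n - flowMin τ (τ 0 n)))).and (eventually_ge_atTop (τ 0 n))).exists
  have h1 := hlt t
  have h2 := hM t ht2
  rw [h.lastServed_eq] at h1
  omega

/-- Right-continuity of the step function makes the infimum attained, so `leaveTime` and
`lastServed` are inverse to each other in the Galois sense. -/
lemma IsStableInput.le_lastServed_iff [NeZero c] {n : ℤ} {t : ℝ} :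
    n ≤ lastServed τ t ↔ leaveTime τ n ≤ t := by
  have hbdd : BddBelow {t | n ≤ lastServed τ t} := by
    refine ⟨τ 0 n, fun t ht => ?_⟩
    have h1 := h.vacQueue_nonneg t
    simp only [Set.mem_ofPred_eq, lastServed] at ht
    exact (h.locallyFinite 0).le_lastLE_iff.mp (by omega)
  refine ⟨fun ht => csInf_le hbdd ht, fun ht => ?_⟩
  refine le_trans ?_ (h.lastServed_mono ht)
  obtain ⟨y, hy, hsub⟩ := mem_nhdsGE_iff_exists_Ico_subset.mp
    (h.eventually_right (leaveTime τ n))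
  obtain ⟨s, hs, hsy⟩ := exists_lt_of_csInf_lt (h.exists_le_lastServed n) hy
  have : lastServed τ s = lastServed τ (leaveTime τ n) := hsub ⟨csInf_le hbdd hs, hsy⟩
  rw [← this]
  exact hs

lemma IsStableInput.lastServed_lt_iff [NeZero c] {n : ℤ} {t : ℝ} :
    lastServed τ t < n ↔ t < leaveTime τ n := by
  rw [← not_le, h.le_lastServed_iff, not_le]

/-- The counter is below `n` just before this time and at least `n` at it. Only an activity start
with a non-empty queue makes it jump, and then by one; disjointness makes the server unique. -/
lemma IsStableInput.leaveTime_spec [NeZero c] (n : ℤ) :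
    lastServed τ (leaveTime τ n) = n ∧ 0 < Function.leftLim (vacQueue τ) (leaveTime τ n) ∧
      ∃! i : Fin c, leaveTime τ n ∈ Set.range (τ i.succ) := by
  have h1 := h.le_lastServed_iff.mpr (le_refl (leaveTime τ n))
  have hex : ∃ i : Fin c, leaveTime τ n ∈ Set.range (τ i.succ) := by
    by_contra! hnot
    obtain ⟨u, hu, hu'⟩ := h.exists_left_of_not_mem hnot
    have := h.lastServed_lt_iff.mpr hu
    omega
  obtain ⟨i, hi⟩ := hex
  obtain ⟨u, hu, -, hlim, hu'⟩ := h.exists_left_activity (sub_one_lt _) hi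
  have h2 := h.lastServed_lt_iff.mpr hu
  refine ⟨?_, ?_, i, hi, fun j hj => ?_⟩
  · split_ifs at hu' <;> omega
  · rw [hlim]
    by_contra h3
    rw [if_neg h3] at hu'
    omega
  · by_contra hne
    exact h.not_mem_range (fun h' => hne (Fin.succ_injective _ h').symm) hi hj

lemma IsStableInput.leaveTime_lastServed [NeZero c] {t : ℝ} {i : Fin c}
    (ht : t ∈ Set.range (τ i.succ)) (hpos : 0 < Function.leftLim (vacQueue τ) t) :
    leaveTime τ (lastServed τ t) = t := by
  refine le_antisymm (h.le_lastServed_iff.mp le_rfl) ?_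
  by_contra! hlt
  obtain ⟨u, hu, hsu, hlim, hu'⟩ := h.exists_left_activity hlt ht
  rw [hlim] at hpos
  rw [if_pos hpos] at hu'
  have := h.le_lastServed_iff.mpr hsu
  omega

end Reflection

/-! ### Delays and service times in the vacation system -/

section Vacation

variable {c : ℕ} [NeZero c] {τ : Fin (c + 1) → ℤ → ℝ} (h : IsStableInput τ)
include h

/-- Service initiations correspond bijectively to the customers who leave: each label `k` is charged
to the unique server whose activity starts at `leaveTime τ k`. -/
lemma IsStableInput.sum_serviceStarts (n : ℤ) {t : ℝ} (ht : 0 ≤ t) :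
    ∑ i : Fin c, (serviceStarts τ i (τ 0 n) t : ℤ) =
      lastServed τ (τ 0 n + t) - lastServed τ (τ 0 n) := by
  choose f hf hfu using fun k => (h.leaveTime_spec k).2.2
  set I := Finset.Ioc (lastServed τ (τ 0 n)) (lastServed τ (τ 0 n + t)) with hI
  have key : ∀ i : Fin c, serviceStarts τ i (τ 0 n) t = (I.filter fun k => f k = i).card := by
    intro i
    rw [serviceStarts, ← Set.ncard_coe_finset]
    have himg : ((I.filter fun k => f k = i : Finset ℤ) : Set ℤ) =
        (fun m => lastServed τ (τ i.succ m)) '' {m : ℤ | τ i.succ m ∈ Set.Icc (τ 0 n) (τ 0 n + t) ∧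
          0 < Function.leftLim (vacQueue τ) (τ i.succ m)} := by
      ext k
      simp only [hI, Finset.coe_filter, Finset.mem_Ioc, Set.mem_ofPred_eq, Set.mem_image,
        Set.mem_Icc]
      constructor
      · rintro ⟨⟨h1, h2⟩, rfl⟩
        obtain ⟨m, hm⟩ := hf k
        rw [h.lastServed_lt_iff] at h1
        rw [h.le_lastServed_iff] at h2
        refine ⟨m, ?_, ?_⟩
        · rw [hm]
          exact ⟨⟨h1.le, h2⟩, (h.leaveTime_spec k).2.1⟩
        · rw [hm]
          exact (h.leaveTime_spec k).1
      · rintro ⟨m, ⟨⟨h1, h2⟩, h3⟩, rfl⟩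
        have h4 := h.leaveTime_lastServed (i := i) ⟨m, rfl⟩ h3
        refine ⟨⟨?_, h.lastServed_mono h2⟩, ?_⟩
        · rw [h.lastServed_lt_iff, h4]
          -- The initiations are counted on a closed interval and the labels on a half-open one;
          -- these agree because no activity starts at an arrival instant.
          exact lt_of_le_of_ne h1 (h.disjoint 0 i.succ (Fin.succ_ne_zero i).symm n m)
        · exact (hfu _ i ⟨m, h4.symm⟩).symm
    rw [himg, Set.InjOn.ncard_image]
    rintro m ⟨-, hm⟩ m' ⟨-, hm'⟩ heq
    have h1 := h.leaveTime_lastServed (i := i) ⟨m, rfl⟩ hm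
    have h2 := h.leaveTime_lastServed (i := i) ⟨m', rfl⟩ hm'
    simp only at heq
    rw [heq, h2] at h1
    exact ((h.locallyFinite i.succ).strictMono.injective h1).symm
  have hle := h.lastServed_mono (show τ 0 n ≤ τ 0 n + t by linarith)
  simp only [key]
  rw [← Nat.cast_sum, ← Finset.card_eq_sum_card_fiberwise
    (fun k _ => Finset.mem_coe.mpr (Finset.mem_univ (f k))),
    Int.card_Ioc, Int.toNat_of_nonneg (by linarith)]

lemma IsStableInput.arrival_lt_leaveTime (n : ℤ) : τ 0 n < leaveTime τ n := by
  have h1 := h.vacQueue_arrival_pos n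
  rw [← h.lastServed_lt_iff, lastServed, (h.locallyFinite 0).lastLE_apply]
  omega

lemma IsStableInput.leaveTime_strictMono : StrictMono (leaveTime τ) := fun m n hmn => by
  rwa [← h.lastServed_lt_iff, (h.leaveTime_spec m).1]

/-- The queue length at the arrival of `n` is `n` minus the counter there, so the defining equation
says that the counter has reached `n`. -/
lemma IsStableInput.isLeast_delaySet (n : ℤ) :
    IsLeast (delaySet τ n) (leaveTime τ n - τ 0 n) := by
  have hmem : ∀ t, t ∈ delaySet τ n ↔ 0 ≤ t ∧ lastServed τ (τ 0 n + t) = n := by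
    intro t
    refine and_congr_right fun ht => ?_
    rw [h.sum_serviceStarts n ht]
    have : lastServed τ (τ 0 n) = n - vacQueue τ (τ 0 n) := by
      rw [lastServed, (h.locallyFinite 0).lastLE_apply]
    constructor <;> intro <;> omega
  constructor
  · rw [hmem, add_sub_cancel]
    exact ⟨sub_nonneg.mpr (h.arrival_lt_leaveTime n).le, (h.leaveTime_spec n).1⟩
  · intro t ht
    have := h.le_lastServed_iff.mp ((hmem t).mp ht).2.ge
    linarith

lemma IsStableInput.add_delay (n : ℤ) : τ 0 n + delay τ n = leaveTime τ n := by
  rw [delay, (h.isLeast_delaySet n).csInf_eq]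
  ring

lemma IsStableInput.serviceTime_eq (n : ℤ) {i : Fin c}
    (hi : leaveTime τ n ∈ Set.range (τ i.succ)) :
    serviceTime τ n = τ i.succ (lastLE (τ i.succ) (leaveTime τ n) + 1) - leaveTime τ n := by
  rw [serviceTime, h.add_delay, Finset.sum_eq_single i, Set.indicator_of_mem hi,
    (h.locallyFinite _).residual_eq]
  · intro j _ hj
    exact Set.indicator_of_notMem
      (h.not_mem_range (fun h' => hj (Fin.succ_injective _ h').symm) hi) _
  · simp

lemma IsStableInput.serviceTime_nonneg (n : ℤ) : 0 ≤ serviceTime τ n := by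
  obtain ⟨i, hi, -⟩ := (h.leaveTime_spec n).2.2
  rw [h.serviceTime_eq n hi]
  exact sub_nonneg.mpr ((h.locallyFinite _).lt_apply_lastLE _).le

/-- In absolute time the delay cancels, leaving the sorted next activity epochs at or after
`leaveTime τ n`. -/
lemma IsStableInput.vacKW_eq (n : ℤ) (j : Fin c) : vacKW τ n j =
    sortVec (fun i : Fin c => τ i.succ (lastLT (τ i.succ) (leaveTime τ n) + 1)) j - τ 0 n := by
  have h1 := h.add_delay n
  have h2 : (fun i : Fin c => Function.leftLim (residual (τ i.succ)) (τ 0 n + delay τ n)) =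
      fun i : Fin c => τ i.succ (lastLT (τ i.succ) (leaveTime τ n) + 1) + -leaveTime τ n := by
    ext i
    rw [h1, (h.locallyFinite i.succ).leftLim_residual]
    ring
  rw [vacKW, h2, sortVec_add_const]
  linarith

lemma IsStableInput.vacKW_nonneg (n : ℤ) : 0 ≤ vacKW τ n := by
  intro j
  rw [h.vacKW_eq]
  have := const_le_sortVec (r := leaveTime τ n)
    (fun i : Fin c => (h.locallyFinite i.succ).le_apply_lastLT (leaveTime τ n)) j
  have := h.arrival_lt_leaveTime n
  simp only [Pi.zero_apply]
  linarith

omit [NeZero c] in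
lemma IsStableInput.apply_lastLT_of_mem {i : Fin (c + 1)} {t : ℝ} (hi : t ∈ Set.range (τ i)) :
    τ i (lastLT (τ i) t + 1) = t := by
  obtain ⟨m, rfl⟩ := hi
  rw [(h.locallyFinite i).lastLT_apply, sub_add_cancel]

/-- Every listed epoch is at least `leaveTime τ n`, with equality only for the initiating server
since epochs are disjoint. The minimum is thus unique, and the service time is added to the right
server. -/
lemma IsStableInput.sort_zero (n : ℤ) {i : Fin c} (hi : leaveTime τ n ∈ Set.range (τ i.succ)) :
    Tuple.sort (fun i : Fin c => τ i.succ (lastLT (τ i.succ) (leaveTime τ n) + 1)) 0 = i := by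
  set g := fun i : Fin c => τ i.succ (lastLT (τ i.succ) (leaveTime τ n) + 1) with hg
  by_contra hne
  have h1 : g (Tuple.sort g 0) ≤ g i := by
    have := sortVec_monotone g (Fin.zero_le ((Tuple.sort g).symm i))
    simpa [sortVec] using this
  have h2 : g i = leaveTime τ n := h.apply_lastLT_of_mem hi
  have h3 : leaveTime τ n ≤ g (Tuple.sort g 0) := (h.locallyFinite _).le_apply_lastLT _
  exact h.not_mem_range (j := (Tuple.sort g 0).succ)
    (fun h' => hne (Fin.succ_injective _ h').symm) hi ⟨_, le_antisymm (h1.trans h2.le) h3⟩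

lemma IsStableInput.vacKW_zero (n : ℤ) : τ 0 n + vacKW τ n 0 = leaveTime τ n := by
  obtain ⟨i, hi, -⟩ := (h.leaveTime_spec n).2.2
  rw [h.vacKW_eq, sortVec, Function.comp_apply, h.sort_zero n hi, h.apply_lastLT_of_mem hi]
  ring

/-- The decisive supersolution property. After the addition, every server shows its first epoch
strictly after `leaveTime τ n`; this is at most its first epoch at or after the later time
`leaveTime τ (n + 1)`. -/
lemma IsStableInput.kwStep_vacKW_le (n : ℤ) :
    kwStep (τ 0) (serviceTime τ) n (vacKW τ n) ≤ vacKW τ (n + 1) := by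
  obtain ⟨i, hi, -⟩ := (h.leaveTime_spec n).2.2
  have hsort := h.sort_zero n hi
  have hg : vacKW τ n = fun j => sortVec
    (fun i : Fin c => τ i.succ (lastLT (τ i.succ) (leaveTime τ n) + 1)) j - τ 0 n :=
    funext (h.vacKW_eq n)
  set σ := Tuple.sort (fun i : Fin c => τ i.succ (lastLT (τ i.succ) (leaveTime τ n) + 1))
    with hσ
  have hinner : (fun j => max (addFirst (vacKW τ n) (serviceTime τ n) j -
      (τ 0 (n + 1) - τ 0 n)) 0) = (fun i : Fin c =>
        max (τ i.succ (lastLE (τ i.succ) (leaveTime τ n) + 1) - τ 0 (n + 1)) 0) ∘ σ := by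
    ext j
    simp only [Function.comp_apply]
    congr 1
    rw [hg, addFirst]
    simp only [sortVec, ← hσ, Function.comp_apply]
    by_cases hj : j = 0
    · subst hj
      simp only [hsort, h.serviceTime_eq n hi, h.apply_lastLT_of_mem hi, Fin.val_zero, if_true]
      ring
    · have hne : i.succ ≠ (σ j).succ := by
        rw [← hsort]
        exact fun h' => hj (σ.injective (Fin.succ_injective _ h')).symm
      rw [h.lastLE_of_ne hne hi, if_neg (fun h' => hj (Fin.ext (by simpa using h')))]
      ring
  rw [kwStep, hinner, sortVec_comp_perm]
  have htarget : vacKW τ (n + 1) = sortVec fun i : Fin c =>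
      τ i.succ (lastLT (τ i.succ) (leaveTime τ (n + 1)) + 1) + -τ 0 (n + 1) := by
    ext j
    rw [h.vacKW_eq, sortVec_add_const, sub_eq_add_neg]
  rw [htarget]
  refine sortVec_mono fun i => max_le ?_ ?_
  · have h1 := (h.locallyFinite i.succ).lastLE_le_lastLT
      (h.leaveTime_strictMono (lt_add_one n))
    have h2 := (h.locallyFinite i.succ).strictMono.monotone (add_le_add_left h1 1)
    linarith
  · have h1 := (h.locallyFinite i.succ).le_apply_lastLT (leaveTime τ (n + 1))
    have h2 := h.arrival_lt_leaveTime (n + 1)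
    linarith

end Vacation

/-! ### Limits -/

section Limits

variable {c : ℕ} [NeZero c] {τ : Fin (c + 1) → ℤ → ℝ} (h : IsStableInput τ)
include h

lemma IsStableInput.KW_vacKW_le {k n : ℤ} (hkn : k ≤ n) :
    KW (τ 0) (serviceTime τ) k n (vacKW τ k) ≤ vacKW τ n :=
  KW_le_of_kwStep_le _ _ h.kwStep_vacKW_le hkn

lemma IsStableInput.KW_zero_le {k n : ℤ} (hkn : k ≤ n) :
    KW (τ 0) (serviceTime τ) k n 0 ≤ vacKW τ n :=
  (KW_mono _ _ hkn (h.vacKW_nonneg k)).trans (h.KW_vacKW_le hkn)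

lemma IsStableInput.exists_tendsto_KW (n : ℤ) : ∃ w : Fin c → ℝ,
    Tendsto (fun k : ℤ => KW (τ 0) (serviceTime τ) k n 0) atBot (𝓝 w) ∧
      ∀ k ≤ n, KW (τ 0) (serviceTime τ) k n 0 ≤ w := by
  -- Truncating the starting label at `n` keeps it where the monotonicity lemma applies and does not
  -- affect the limit at `-∞`.
  have hanti : ∀ i : Fin c, Antitone fun k : ℤ => KW (τ 0) (serviceTime τ) (min k n) n 0 i :=
    fun i j k hjk => KW_zero_antitone _ _ (min_le_min_right n hjk) (min_le_right _ _) i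
  have hbdd : ∀ i : Fin c, BddAbove
      (Set.range fun k : ℤ => KW (τ 0) (serviceTime τ) (min k n) n 0 i) := by
    intro i
    refine ⟨vacKW τ n i, ?_⟩
    rintro _ ⟨k, rfl⟩
    exact h.KW_zero_le (min_le_right _ _) i
  refine ⟨fun i => ⨆ k : ℤ, KW (τ 0) (serviceTime τ) (min k n) n 0 i, ?_, fun k hk i => ?_⟩
  · refine tendsto_pi_nhds.mpr fun i => (tendsto_atBot_ciSup (hanti i) (hbdd i)).congr' ?_
    filter_upwards [eventually_le_atBot n] with k hk
    rw [min_eq_left hk]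
  · simpa only [min_eq_left hk] using le_ciSup (hbdd i) k

lemma IsStableInput.startTime_le {N n : ℤ} (hn : N ≤ n) :
    startTime c (τ 0) (serviceTime τ) N n ≤ leaveTime τ n := by
  rw [startTime_eq h.serviceTime_nonneg hn, ← h.vacKW_zero n]
  exact add_le_add_right (h.KW_zero_le hn 0) _

omit [NeZero c] in
lemma IsStableInput.queueFrom_eq (u t : ℝ) :
    queueFrom c (τ 0) (serviceTime τ) u (t - u) = {n : ℤ | lastLE (τ 0) u + 1 ≤ n ∧
      n ≤ lastLE (τ 0) t ∧
        t < startTime c (τ 0) (serviceTime τ) (lastLE (τ 0) u + 1) n}.ncard := by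
  simp only [queueFrom, startFrom, add_sub_cancel, (h.locallyFinite 0).firstAfter_eq,
    (h.locallyFinite 0).le_lastLE_iff, Int.add_one_le_iff, (h.locallyFinite 0).lastLE_lt_iff]

lemma IsStableInput.queueFrom_le (u t : ℝ) :
    (queueFrom c (τ 0) (serviceTime τ) u (t - u) : ℤ) ≤ vacQueue τ t := by
  -- Whoever still waits at `t` has a start time after `t`, hence has not yet left the vacation
  -- queue either.
  have hsub : {n : ℤ | lastLE (τ 0) u + 1 ≤ n ∧ n ≤ lastLE (τ 0) t ∧
      t < startTime c (τ 0) (serviceTime τ) (lastLE (τ 0) u + 1) n} ⊆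
      ((Finset.Ioc (lastServed τ t) (lastLE (τ 0) t) : Finset ℤ) : Set ℤ) := by
    rintro n ⟨h1, h2, h3⟩
    rw [Finset.coe_Ioc]
    exact ⟨h.lastServed_lt_iff.mpr (h3.trans_le (h.startTime_le h1)), h2⟩
  have hle := Set.ncard_le_ncard hsub (Finset.finite_toSet _)
  rw [Set.ncard_coe_finset, Int.card_Ioc, ← h.queueFrom_eq] at hle
  have h1 := h.vacQueue_nonneg t
  have h2 : lastLE (τ 0) t - lastServed τ t = vacQueue τ t := by
    rw [lastServed]
    ring
  omega

lemma IsStableInput.queueFrom_anti (t : ℝ) :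
    Antitone fun u => queueFrom c (τ 0) (serviceTime τ) u (t - u) := by
  intro u u' huu
  have hN := (h.locallyFinite 0).lastLE_mono huu
  simp only [h.queueFrom_eq]
  refine Set.ncard_le_ncard ?_ ((Set.finite_Icc (lastLE (τ 0) u + 1) (lastLE (τ 0) t)).subset
    fun n hn => ⟨hn.1, hn.2.1⟩)
  rintro n ⟨h1, h2, h3⟩
  have h4 : lastLE (τ 0) u + 1 ≤ n := by omega
  refine ⟨h4, h2, h3.trans_le ?_⟩
  rw [startTime_eq h.serviceTime_nonneg h1, startTime_eq h.serviceTime_nonneg h4]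
  exact add_le_add_right (KW_zero_antitone _ _ (by omega) h1 0) _

lemma IsStableInput.exists_queueFrom_eq (t : ℝ) : ∃ q : ℕ, (q : ℤ) ≤ vacQueue τ t ∧
    ∀ᶠ u in atBot, queueFrom c (τ 0) (serviceTime τ) u (t - u) = q := by
  set f := fun u => queueFrom c (τ 0) (serviceTime τ) u (t - u)
  have hbdd : BddAbove (Set.range f) := by
    refine ⟨(vacQueue τ t).toNat, ?_⟩
    rintro _ ⟨u, rfl⟩
    have := h.queueFrom_le u t
    simp only [f]
    omega
  obtain ⟨u₀, hu₀⟩ := Nat.sSup_mem (Set.range_nonempty f) hbdd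
  refine ⟨f u₀, h.queueFrom_le u₀ t, ?_⟩
  filter_upwards [eventually_le_atBot u₀] with u hu
  exact le_antisymm (hu₀ ▸ le_csSup hbdd ⟨u, rfl⟩) (h.queueFrom_anti t hu)

/-- If `q` customers are waiting at time `t`, the customers who have started service are the
ones up to the label `lastLE (τ 0) t - q`. -/
lemma IsStableInput.startTime_le_iff {u t : ℝ} {q : ℕ}
    (hq : queueFrom c (τ 0) (serviceTime τ) u (t - u) = q) {n : ℤ}
    (h1 : lastLE (τ 0) u + 1 ≤ n) (h2 : n ≤ lastLE (τ 0) t) :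
    startTime c (τ 0) (serviceTime τ) (lastLE (τ 0) u + 1) n ≤ t ↔ n ≤ lastLE (τ 0) t - q := by
  rw [h.queueFrom_eq] at hq
  set N := lastLE (τ 0) u + 1
  set A := {n : ℤ | N ≤ n ∧ n ≤ lastLE (τ 0) t ∧ t < startTime c (τ 0) (serviceTime τ) N n}
    with hA
  constructor
  · intro hs
    have hsub : A ⊆ ((Finset.Ioc n (lastLE (τ 0) t) : Finset ℤ) : Set ℤ) := by
      rintro m ⟨hm1, hm2, hm3⟩
      rw [Finset.coe_Ioc]
      refine ⟨?_, hm2⟩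
      by_contra! hmn
      exact absurd (hs.trans_lt hm3) (not_lt.mpr (startTime_mono h.serviceTime_nonneg hm1 hmn))
    have hle := Set.ncard_le_ncard hsub (Finset.finite_toSet _)
    rw [Set.ncard_coe_finset, Int.card_Ioc, hq] at hle
    omega
  · intro hn
    by_contra! hs
    have hsub : ((Finset.Icc n (lastLE (τ 0) t) : Finset ℤ) : Set ℤ) ⊆ A := by
      intro m hm
      rw [Finset.coe_Icc] at hm
      exact ⟨h1.trans hm.1, hm.2, hs.trans_le (startTime_mono h.serviceTime_nonneg h1 hm.1)⟩
    have hfin : A.Finite := (Set.finite_Icc N (lastLE (τ 0) t)).subset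
      fun n hn => ⟨hn.1, hn.2.1⟩
    have hle := Set.ncard_le_ncard hsub hfin
    rw [Set.ncard_coe_finset, Int.card_Icc, hq] at hle
    omega

/-- With `q` customers waiting, `m = lastLE (τ 0) t - q` is the last to have started. Service times
still running at `t` are counted by `encard_addFirst` at customer `m`, so the vector is a
Kiefer–Wolfowitz step with `t` in place of the next arrival. -/
lemma IsStableInput.remainingFrom_eq {u t : ℝ} {q : ℕ}
    (hq : queueFrom c (τ 0) (serviceTime τ) u (t - u) = q)
    (hN : lastLE (τ 0) u + 1 ≤ lastLE (τ 0) t - q) :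
    remainingFrom c (τ 0) (serviceTime τ) u (t - u) = sortVec fun i => max (addFirst
      (KW (τ 0) (serviceTime τ) (lastLE (τ 0) u + 1) (lastLE (τ 0) t - q) 0)
      (serviceTime τ (lastLE (τ 0) t - q)) i - (t - τ 0 (lastLE (τ 0) t - q))) 0 := by
  set m := lastLE (τ 0) t - q with hm
  set N := lastLE (τ 0) u + 1
  set w : Fin c → ℝ := fun i => max (addFirst (KW (τ 0) (serviceTime τ) N m 0)
    (serviceTime τ m) i - (t - τ 0 m)) 0
  have hmt : startTime c (τ 0) (serviceTime τ) N m ≤ t :=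
    (h.startTime_le_iff hq hN (by omega)).mpr le_rfl
  ext i
  have hset : {x : ℝ | 0 ≤ x ∧ {n : ℤ | u < τ 0 n ∧ τ 0 n ≤ u + (t - u) ∧
      startFrom c (τ 0) (serviceTime τ) u n ≤ u + (t - u) ∧
      x < startFrom c (τ 0) (serviceTime τ) u n + serviceTime τ n - (u + (t - u))}.encard ≤
        ((Fin.rev i : ℕ) : ℕ∞)} = Set.Ici (sortVec w i) := by
    ext x
    have hcust : {n : ℤ | u < τ 0 n ∧ τ 0 n ≤ u + (t - u) ∧
        startFrom c (τ 0) (serviceTime τ) u n ≤ u + (t - u) ∧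
        x < startFrom c (τ 0) (serviceTime τ) u n + serviceTime τ n - (u + (t - u))} =
        {n | n ∈ Set.Ico N (m + 1) ∧
          t + x < startTime c (τ 0) (serviceTime τ) N n + serviceTime τ n} := by
      ext n
      simp only [startFrom, (h.locallyFinite 0).firstAfter_eq, add_sub_cancel, Set.mem_ofPred_eq,
        Set.mem_Ico, Int.lt_add_one_iff, ← (h.locallyFinite 0).le_lastLE_iff,
        ← (h.locallyFinite 0).lastLE_lt_iff, ← Int.add_one_le_iff (a := lastLE (τ 0) u)]
      constructor
      · rintro ⟨h1, h2, h3, h4⟩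
        exact ⟨⟨h1, (h.startTime_le_iff hq h1 h2).mp h3⟩, by linarith⟩
      · rintro ⟨⟨h1, h2⟩, h3⟩
        have h4 : n ≤ lastLE (τ 0) t := by omega
        exact ⟨h1, h4, (h.startTime_le_iff hq h1 h4).mpr h2, by linarith⟩
    rw [Set.mem_ofPred_eq, hcust, Set.mem_Ici]
    constructor
    · rintro ⟨hx, hcard⟩
      rw [← (kwInvariant h.serviceTime_nonneg hN).encard_addFirst hN (t + x) (by linarith)]
        at hcard
      rw [sortVec_le_iff]
      refine (Set.encard_le_encard fun j hj => ?_).trans hcard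
      have hj : x < w j := hj
      rcases lt_max_iff.mp hj with hj | hj
      · simp only [Set.mem_ofPred_eq]
        linarith
      · exact absurd hj (not_lt.mpr hx)
    · intro hx
      have hx0 : 0 ≤ x := (const_le_sortVec (fun _ => le_max_right _ _) i).trans hx
      refine ⟨hx0, ?_⟩
      rw [← (kwInvariant h.serviceTime_nonneg hN).encard_addFirst hN (t + x) (by linarith)]
      rw [sortVec_le_iff] at hx
      refine (Set.encard_le_encard fun j hj => ?_).trans hx
      simp only [Set.mem_ofPred_eq] at hj
      exact lt_max_of_lt_left (a := x) (c := (0 : ℝ)) (by linarith)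
  rw [remainingFrom, hset, csInf_Ici]

lemma IsStableInput.exists_tendsto_stateFrom (t : ℝ) : ∃ z : ℕ × (Fin c → ℝ) × ℝ,
    Tendsto (fun u : ℝ => stateFrom c (τ 0) (serviceTime τ) u (t - u)) atBot (𝓝 z) ∧
      (z.1 : ℤ) ≤ vacQueue τ t := by
  obtain ⟨q, hq, hev⟩ := h.exists_queueFrom_eq t
  -- This label no longer depends on `u`, so the convergence of one Kiefer–Wolfowitz vector
  -- suffices.
  set m := lastLE (τ 0) t - q
  obtain ⟨w, hw, -⟩ := h.exists_tendsto_KW m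
  have hN : Tendsto (fun u => lastLE (τ 0) u + 1) atBot atBot :=
    tendsto_atBot_add_const_right _ _ (tendsto_atBot.mpr fun n =>
      (eventually_lt_atBot (τ 0 n)).mono fun u hu =>
        ((h.locallyFinite 0).lastLE_lt_iff.mpr hu).le)
  refine ⟨(q, sortVec fun i => max (addFirst w (serviceTime τ m) i - (t - τ 0 m)) 0,
    age (τ 0) t), ?_, hq⟩
  simp only [stateFrom]
  refine Tendsto.prodMk_nhds ?_ (Tendsto.prodMk_nhds ?_ ?_)
  · exact tendsto_const_nhds.congr' (hev.mono fun u hu => hu.symm)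
  · have hinner : Continuous fun (w : Fin c → ℝ) (i : Fin c) =>
        max (addFirst w (serviceTime τ m) i - (t - τ 0 m)) 0 := by
      refine continuous_pi fun i => ?_
      simp only [addFirst]
      fun_prop
    have hcont := continuous_sortVec.comp hinner
    refine ((hcont.tendsto w).comp (hw.comp hN)).congr' ?_
    filter_upwards [hev, hN.eventually (eventually_le_atBot m)] with u hu hu'
    exact (h.remainingFrom_eq hu hu').symm
  · simp only [add_sub_cancel]
    exact tendsto_const_nhds

/-- The pathwise form of the main theorem. -/
theorem IsStableInput.stationary_limits :
    (∀ t : ℝ, BddAbove ((fun s => netInput τ s t) '' Set.Iic t)) ∧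
      (∀ n : ℤ, (delaySet τ n).Nonempty ∧
        ∃! i : Fin c, τ 0 n + delay τ n ∈ Set.range (τ i.succ)) ∧
      ∃ (W : ℤ → Fin c → ℝ) (Z : ℝ → ℕ × (Fin c → ℝ) × ℝ),
        (∀ n : ℤ, Tendsto (fun k : ℤ => KW (τ 0) (serviceTime τ) k n 0) atBot (𝓝 (W n))) ∧
        (∀ t : ℝ, Tendsto (fun u : ℝ => stateFrom c (τ 0) (serviceTime τ) u (t - u))
          atBot (𝓝 (Z t))) ∧
        (∀ n : ℤ, W n ≤ vacKW τ n) ∧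
        (∀ t : ℝ, ((Z t).1 : ℤ) ≤ vacQueue τ t) ∧
        (∀ k n : ℤ, k ≤ n → n ≤ -1 →
          KW (τ 0) (serviceTime τ) k n 0 ≤ W n ∧
          W n ≤ KW (τ 0) (serviceTime τ) k n (vacKW τ k)) := by
  choose W hW hW' using h.exists_tendsto_KW
  choose Z hZ hZ' using h.exists_tendsto_stateFrom
  refine ⟨h.bddAbove, fun n => ⟨⟨_, (h.isLeast_delaySet n).1⟩, ?_⟩, W, Z, hW, hZ, fun n => ?_, hZ',
    fun k n hkn _ => ⟨hW' n k hkn, ?_⟩⟩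
  · rw [h.add_delay]
    exact (h.leaveTime_spec n).2.2
  · exact le_of_tendsto (hW n) ((eventually_le_atBot n).mono fun k hk => h.KW_zero_le hk)
  · refine le_of_tendsto (hW n) ((eventually_le_atBot k).mono fun j hj => ?_)
    rw [← KW_KW _ _ hj hkn]
    exact KW_mono _ _ hkn (h.KW_zero_le hj)

end Limits

/-! ### Growth of the point sequences -/

section Growth

lemma isLocallyFinite_of_tendsto_div {x : ℤ → ℝ} {m : ℝ} (hm : 0 < m) (hx : StrictMono x)
    (h1 : Tendsto (fun n : ℕ => x n / n) atTop (𝓝 m))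
    (h2 : Tendsto (fun n : ℕ => x (-1 - n) / n) atTop (𝓝 (-m))) : IsLocallyFinite x := by
  have hn := tendsto_natCast_atTop_atTop (R := ℝ)
  have e1 : Tendsto (fun n : ℕ => x n) atTop atTop := by
    refine (h1.pos_mul_atTop hm hn).congr' ?_
    filter_upwards [eventually_gt_atTop 0] with n hn
    have : (n : ℝ) ≠ 0 := by positivity
    field_simp
  have e2 : Tendsto (fun n : ℕ => x (-1 - n)) atTop atBot := by
    refine (h2.neg_mul_atTop (neg_lt_zero.mpr hm) hn).congr' ?_
    filter_upwards [eventually_gt_atTop 0] with n hn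
    have : (n : ℝ) ≠ 0 := by positivity
    field_simp
  refine ⟨hx, tendsto_atTop_atTop_of_monotone hx.monotone fun b => ?_,
    tendsto_atBot_atBot_of_monotone hx.monotone fun b => ?_⟩
  · obtain ⟨n, hn⟩ := (e1.eventually (eventually_ge_atTop b)).exists
    exact ⟨n, hn⟩
  · obtain ⟨n, hn⟩ := (e2.eventually (eventually_le_atBot b)).exists
    exact ⟨_, hn⟩

lemma tendsto_neg_div_atBot {a : ℝ} (ha : 0 < a) :
    Tendsto (fun s : ℝ => -s / a) atBot atTop :=
  tendsto_neg_atBot_atTop.atTop_div_const ha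

lemma IsLocallyFinite.eventually_le_lastLE {x : ℤ → ℝ} (hx : IsLocallyFinite x) {m a : ℝ}
    (ha : 0 < a) (ham : a < m) (h : Tendsto (fun n : ℕ => x (-1 - n) / n) atTop (𝓝 (-m))) :
    ∀ᶠ s in atBot, s / a - 2 ≤ lastLE x s := by
  have hev : ∀ᶠ n : ℕ in atTop, x (-1 - n) ≤ -a * n := by
    filter_upwards [h.eventually (eventually_lt_nhds (neg_lt_neg ham)),
      eventually_gt_atTop 0] with n hn hpos
    exact ((div_lt_iff₀ (by positivity)).mp hn).le
  -- With `n = ⌈-s / a⌉₊`, the point labelled `-1 - n` lies at or before `s`. The loss of `2` is one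
  -- unit from the label offset and one from rounding up.
  filter_upwards [(tendsto_nat_ceil_atTop.comp (tendsto_neg_div_atBot ha)).eventually hev,
    eventually_le_atBot 0] with s hs hs0
  simp only [Function.comp_apply] at hs
  have h1 := Nat.le_ceil (-s / a)
  have h2 := Nat.ceil_lt_add_one (div_nonneg (neg_nonneg.mpr hs0) ha.le)
  have h3 : x (-1 - (⌈-s / a⌉₊ : ℤ)) ≤ s := by
    rw [div_le_iff₀ ha] at h1
    linarith
  have h4 : ((-1 - (⌈-s / a⌉₊ : ℤ) : ℤ) : ℝ) ≤ lastLE x s :=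
    Int.cast_le.mpr (hx.le_lastLE_iff.mpr h3)
  push_cast at h4
  rw [neg_div] at h2
  rw [neg_div] at h4
  linarith

lemma IsLocallyFinite.eventually_lastLE_le {x : ℤ → ℝ} (hx : IsLocallyFinite x) {m b : ℝ}
    (hb : 0 < b) (hbm : m < b) (h : Tendsto (fun n : ℕ => x (-1 - n) / n) atTop (𝓝 (-m))) :
    ∀ᶠ s in atBot, (lastLE x s : ℝ) ≤ s / b := by
  have hev : ∀ᶠ n : ℕ in atTop, -b * n ≤ x (-1 - n) := by
    filter_upwards [h.eventually (eventually_gt_nhds (neg_lt_neg hbm)),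
      eventually_gt_atTop 0] with n hn hpos
    exact ((lt_div_iff₀ (by positivity)).mp hn).le
  filter_upwards [(tendsto_nat_floor_atTop.comp (tendsto_neg_div_atBot hb)).eventually hev,
    eventually_le_atBot 0] with s hs hs0
  simp only [Function.comp_apply] at hs
  have h1 := Nat.floor_le (div_nonneg (neg_nonneg.mpr hs0) hb.le)
  have h2 := Nat.lt_floor_add_one (-s / b)
  -- Passing to the next label gives the strict inequality, and its extra unit absorbs the rounding
  -- error, so no constant is lost.
  have h3 : s < x (-(⌊-s / b⌋₊ : ℤ)) := by
    rw [le_div_iff₀ hb] at h1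
    have : x (-1 - (⌊-s / b⌋₊ : ℤ)) < x (-(⌊-s / b⌋₊ : ℤ)) := hx.strictMono (by omega)
    linarith
  have h4 : ((lastLE x s + 1 : ℤ) : ℝ) ≤ ((-(⌊-s / b⌋₊ : ℤ) : ℤ) : ℝ) :=
    Int.cast_le.mpr (Int.add_one_le_iff.mpr (hx.lastLE_lt_iff.mpr h3))
  push_cast at h4
  rw [neg_div] at h2
  rw [neg_div] at h4
  linarith

/-- Far in the past, the arrival labels are at least about `s / a` and each server's labels at most
`s / (c * a)`. Summed over the `c` servers the linear terms cancel, so `flow` is bounded below near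
`-∞`. -/
lemma bddAbove_netInput {c : ℕ} (hc : 1 ≤ c) {τ : Fin (c + 1) → ℤ → ℝ} {m₀ m₁ : ℝ}
    (hm₁ : 0 < m₁) (hm : m₁ < c * m₀) (hτ : ∀ i, IsLocallyFinite (τ i))
    (h0 : Tendsto (fun n : ℕ => τ 0 (-1 - n) / n) atTop (𝓝 (-m₀)))
    (h1 : ∀ i : Fin c, Tendsto (fun n : ℕ => τ i.succ (-1 - n) / n) atTop (𝓝 (-m₁))) (t : ℝ) :
    BddAbove ((fun s => netInput τ s t) '' Set.Iic t) := by
  have hc0 : (0 : ℝ) < c := by exact_mod_cast hc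
  obtain ⟨a, ha1, ha2⟩ := exists_between ((div_lt_iff₀' hc0).mpr hm)
  have ha : 0 < a := (div_pos hm₁ hc0).trans ha1
  have hb : m₁ < c * a := (div_lt_iff₀' hc0).mp ha1
  have hev : ∀ᶠ s in atBot, -2 ≤ flow τ s := by
    filter_upwards [(hτ 0).eventually_le_lastLE ha ha2 h0, eventually_all.mpr fun i : Fin c =>
      (hτ i.succ).eventually_lastLE_le (mul_pos hc0 ha) hb (h1 i)] with s hs0 hs1
    have hsum : (activities τ s : ℝ) ≤ s / a := by
      rw [activities, Int.cast_sum]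
      refine (Finset.sum_le_sum fun i _ => hs1 i).trans (le_of_eq ?_)
      rw [Finset.sum_const, Finset.card_univ, Fintype.card_fin, nsmul_eq_mul]
      field_simp
    have : ((-2 : ℤ) : ℝ) ≤ (flow τ s : ℝ) := by
      rw [flow]
      push_cast
      linarith
    exact_mod_cast this
  obtain ⟨s₀, hs₀⟩ := eventually_atBot.mp hev
  refine ⟨max (flow τ t + 2) (flow τ t - (lastLE (τ 0) s₀ - activities τ t)), ?_⟩
  rintro _ ⟨s, hs, rfl⟩
  simp only [netInput_eq hτ hs]
  rcases le_total s s₀ with h | h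
  · exact le_max_of_le_left (by linarith [hs₀ s h])
  · refine le_max_of_le_right (sub_le_sub_left ?_ _)
    rw [flow]
    exact sub_le_sub ((hτ 0).lastLE_mono h)
      (Finset.sum_le_sum fun i _ => (hτ i.succ).lastLE_mono hs)

end Growth

/-! ### Stationary renewal processes -/

section Renewal

variable {Ω : Type*} [MeasurableSpace Ω] {P : Measure Ω} {ν : Measure ℝ} {T : ℤ → Ω → ℝ}

/-- The enumeration `f` runs through gaps other than the one straddling the origin, which need not
have law `ν`. -/
lemma IsStationaryRenewal.tendsto_gap_average (hT : IsStationaryRenewal P ν T)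
    (hν : Integrable (fun x : ℝ => x) ν) (f : ℕ → ℤ) (hf : Function.Injective f)
    (hf' : ∀ k, f k ≠ -1) :
    ∀ᵐ ω ∂P, Tendsto (fun n : ℕ => (∑ k ∈ Finset.range n, (T (f k + 1) ω - T (f k) ω)) / n) atTop
      (𝓝 (∫ x, x ∂ν)) := by
  have hmeas : ∀ n, Measurable fun ω => T (n + 1) ω - T n ω := fun n =>
    (hT.measurable _).sub (hT.measurable _)
  have hint : Integrable (fun ω => T (f 0 + 1) ω - T (f 0) ω) P := by
    rw [← hT.gap_law (f 0) (hf' 0)] at hν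
    exact hν.comp_measurable (hmeas _)
  have hlaw := strong_law_ae_real (μ := P) (fun k ω => T (f k + 1) ω - T (f k) ω) hint
    (fun i j hij => hT.gap_indep.indepFun (i := ⟨f i, hf' i⟩) (j := ⟨f j, hf' j⟩)
      fun h => hij (hf (Subtype.ext_iff.mp h)))
    (fun i => ⟨(hmeas _).aemeasurable, (hmeas _).aemeasurable, by
      rw [hT.gap_law _ (hf' i), hT.gap_law _ (hf' 0)]⟩)
  have hmean : ∫ ω, (T (f 0 + 1) ω - T (f 0) ω) ∂P = ∫ x, x ∂ν := by
    rw [← hT.gap_law (f 0) (hf' 0), integral_map (hmeas _).aemeasurable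
      (f := fun x : ℝ => x) measurable_id.aestronglyMeasurable]
  rwa [hmean] at hlaw

lemma IsStationaryRenewal.tendsto_div (hT : IsStationaryRenewal P ν T)
    (hν : Integrable (fun x : ℝ => x) ν) :
    ∀ᵐ ω ∂P, Tendsto (fun n : ℕ => T n ω / n) atTop (𝓝 (∫ x, x ∂ν)) ∧
      Tendsto (fun n : ℕ => T (-1 - n) ω / n) atTop (𝓝 (-∫ x, x ∂ν)) := by
  filter_upwards [hT.tendsto_gap_average hν (fun k => (k : ℤ)) Nat.cast_injective
      (fun k => by omega),
    hT.tendsto_gap_average hν (fun k => -2 - (k : ℤ)) (fun i j hij => by simpa using hij)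
      (fun k => by omega)] with ω h1 h2
  have e1 : ∀ n : ℕ, ∑ k ∈ Finset.range n, (T ((k : ℤ) + 1) ω - T k ω) = T n ω - T 0 ω := fun n => by
    have := Finset.sum_range_sub (fun k : ℕ => T k ω) n
    simpa using this
  have e2 : ∀ n : ℕ, ∑ k ∈ Finset.range n, (T (-2 - (k : ℤ) + 1) ω - T (-2 - k) ω) =
      T (-1) ω - T (-1 - n) ω := fun n => by
    have := Finset.sum_range_sub' (fun k : ℕ => T (-1 - (k : ℤ)) ω) n
    simp only [Nat.cast_zero, sub_zero] at this
    rw [← this]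
    refine Finset.sum_congr rfl fun k _ => ?_
    push_cast
    congr 2 <;> ring
  simp only [e1] at h1
  simp only [e2] at h2
  constructor
  · have := h1.add (tendsto_const_div_atTop_nhds_zero_nat (T 0 ω))
    rw [add_zero] at this
    refine this.congr fun n => ?_
    rw [← add_div, sub_add_cancel]
  · have := (tendsto_const_div_atTop_nhds_zero_nat (T (-1) ω)).sub h2
    rw [zero_sub] at this
    refine this.congr fun n => ?_
    rw [← sub_div, sub_sub_cancel]

lemma IsStationaryRenewal.ae_isLocallyFinite (hT : IsStationaryRenewal P ν T)
    (hν : Integrable (fun x : ℝ => x) ν) (hpos : 0 < ∫ x, x ∂ν) :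
    ∀ᵐ ω ∂P, IsLocallyFinite fun n => T n ω := by
  filter_upwards [hT.tendsto_div hν, hT.strictMono] with ω h hmono
  exact isLocallyFinite_of_tendsto_div hpos hmono h.1 h.2

/-- Stationarity is a statement about counts, so being a point is encoded by countably many of them.
-/
lemma IsLocallyFinite.mem_range_iff_count {x : ℤ → ℝ} (hx : IsLocallyFinite x) (u : ℝ) :
    u ∈ Set.range x ↔ ∀ k : ℕ, 1 ≤ count x (Set.Ioc (u - 1 / (k + 1)) u) := by
  have hk : ∀ k : ℕ, u - 1 / ((k : ℝ) + 1) < u := fun k =>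
    sub_lt_self _ Nat.one_div_pos_of_nat
  constructor
  · intro hu k
    have h1 := hx.count_Ioc (hk k).le
    have h2 := hx.lastLE_le_lastLT (hk k)
    rw [hx.lastLE_eq_lastLT_add_one hu] at h1
    omega
  · intro h
    by_contra hu
    have hlim : Tendsto (fun k : ℕ => u - 1 / ((k : ℝ) + 1)) atTop (𝓝[<] u) := by
      refine tendsto_nhdsWithin_iff.mpr ⟨?_, Eventually.of_forall hk⟩
      simpa using tendsto_const_nhds.sub (tendsto_one_div_add_atTop_nhds_zero_nat (𝕜 := ℝ))
    obtain ⟨k, hk'⟩ := (hlim.eventually (hx.eventually_lastLE_left u)).exists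
    have h1 := hx.count_Ioc (hk k).le
    rw [hk', hx.lastLE_eq_lastLT hu] at h1
    have := h k
    omega

/-- The origin is almost surely not a point, and shift invariance of the counts carries this to
every fixed `u`. -/
lemma IsStationaryRenewal.ae_notMem_range (hT : IsStationaryRenewal P ν T)
    (hν : Integrable (fun x : ℝ => x) ν) (hpos : 0 < ∫ x, x ∂ν) (u : ℝ) :
    ∀ᵐ ω ∂P, u ∉ Set.range fun n => T n ω := by
  set B : Set (ℝ × ℝ → ℕ) := ⋂ k : ℕ, {g | 1 ≤ g (-(1 / ((k : ℝ) + 1)), 0)} with hB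
  have hBm : MeasurableSet B := MeasurableSet.iInter fun k =>
    measurableSet_le measurable_const (measurable_pi_apply _)
  have hmem : ∀ᵐ ω ∂P, ∀ v : ℝ, v ∈ Set.range (fun n => T n ω) ↔
      (fun p : ℝ × ℝ => count (fun n => T n ω) (Set.Ioc (p.1 + v) (p.2 + v))) ∈ B := by
    filter_upwards [hT.ae_isLocallyFinite hν hpos] with ω hω v
    rw [hω.mem_range_iff_count]
    simp only [hB, Set.mem_iInter, Set.mem_ofPred_eq, zero_add, neg_add_eq_sub]
  have h0 : ∀ᵐ ω ∂P, (fun p : ℝ × ℝ => count (fun n => T n ω) (Set.Ioc p.1 p.2)) ∉ B := by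
    filter_upwards [hmem, hT.origin, hT.strictMono] with ω hω horig hmono hBω
    have : (0 : ℝ) ∈ Set.range (fun n => T n ω) := by
      rw [hω 0]
      simpa using hBω
    obtain ⟨n, hn⟩ := this
    simp only at hn
    rcases le_or_gt n (-1) with h | h
    · have : T n ω ≤ T (-1) ω := hmono.monotone h
      linarith [horig.1]
    · have : T 0 ω ≤ T n ω := hmono.monotone (by omega)
      linarith [horig.2]
  have hu : P ((fun ω (p : ℝ × ℝ) => count (fun n => T n ω) (Set.Ioc (p.1 + u) (p.2 + u))) ⁻¹' B)
      = 0 := by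
    rw [(hT.stationary u).measure_mem_eq hBm]
    exact measure_eq_zero_iff_ae_notMem.mpr h0
  have hu' : ∀ᵐ ω ∂P, (fun p : ℝ × ℝ => count (fun n => T n ω) (Set.Ioc (p.1 + u) (p.2 + u))) ∉ B :=
    measure_eq_zero_iff_ae_notMem.mp hu
  filter_upwards [hmem, hu'] with ω h1 h2 h3
  exact h2 ((h1 u).mp h3)

/-- By Fubini the diagonal is null for a product law whose second factor has no atoms. -/
lemma ae_ne_of_indepFun [IsFiniteMeasure P] {X Y : Ω → ℝ} (hX : Measurable X) (hY : Measurable Y)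
    (hXY : IndepFun X Y P) (hatom : ∀ x, ∀ᵐ ω ∂P, Y ω ≠ x) : ∀ᵐ ω ∂P, X ω ≠ Y ω := by
  have hdiag : MeasurableSet {p : ℝ × ℝ | p.1 = p.2} :=
    measurableSet_eq_fun measurable_fst measurable_snd
  have hprod := (indepFun_iff_map_prod_eq_prod_map_map hX.aemeasurable hY.aemeasurable).mp hXY
  have hnull : (P.map fun ω => (X ω, Y ω)) {p : ℝ × ℝ | p.1 = p.2} = 0 := by
    rw [hprod, Measure.measure_prod_null hdiag]
    refine Eventually.of_forall fun x => ?_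
    have : Prod.mk x ⁻¹' {p : ℝ × ℝ | p.1 = p.2} = {x} := by
      ext y
      simp [eq_comm]
    simp only [this, Pi.zero_apply]
    rw [Measure.map_apply hY (measurableSet_singleton x)]
    exact measure_eq_zero_iff_ae_notMem.mpr (hatom x)
  rw [Measure.map_apply (hX.prodMk hY) hdiag] at hnull
  simpa [ae_iff] using hnull

lemma integrable_id_of_rpow [IsFiniteMeasure ν] (hν : ∀ᵐ x ∂ν, 0 < x) {p : ℝ} (hp : 1 ≤ p)
    (h : Integrable (fun x : ℝ => x ^ p) ν) : Integrable (fun x : ℝ => x) ν := by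
  refine ((integrable_const (1 : ℝ)).add h).mono' measurable_id.aestronglyMeasurable ?_
  filter_upwards [hν] with x hx
  rw [Real.norm_of_nonneg hx.le]
  have hxp := Real.rpow_nonneg hx.le p
  rcases le_total x 1 with h1 | h1
  · simp only [Pi.add_apply]
    linarith
  · have := Real.rpow_le_rpow_of_exponent_le h1 hp
    rw [Real.rpow_one] at this
    simp only [Pi.add_apply]
    linarith

lemma integral_id_pos [IsProbabilityMeasure ν] (hν : ∀ᵐ x ∂ν, 0 < x)
    (h : Integrable (fun x : ℝ => x) ν) : 0 < ∫ x, x ∂ν := by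
  rw [integral_pos_iff_support_of_nonneg_ae (hν.mono fun x hx => hx.le) h]
  refine pos_iff_ne_zero.mpr fun h0 => ?_
  obtain ⟨x, hx, hx'⟩ := (hν.and (measure_eq_zero_iff_ae_notMem.mp h0)).exists
  exact hx' hx.ne'

end Renewal

end MultiServer

theorem mainTheorem2 {Ω : Type*} [MeasurableSpace Ω] (P : Measure Ω) [IsProbabilityMeasure P]
    (c : ℕ) (hc : 1 ≤ c)
    -- laws of the interarrival times and of the service times
    (G F : Measure ℝ) [IsProbabilityMeasure G] [IsProbabilityMeasure F]
    (hG : ∀ᵐ x ∂G, 0 < x) (hF : ∀ᵐ x ∂F, 0 < x)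
    (ε : ℝ) (hε : 0 < ε)
    (hGm : Integrable (fun x : ℝ => x ^ (2 + ε)) G)
    (hFm : Integrable (fun x : ℝ => x ^ (2 + ε)) F)
    -- stability: the traffic intensity `E V / (c * E A)` is less than one
    (hstab : ∫ x, x ∂F < c * ∫ x, x ∂G)
    -- arrival process (index `0`) and activity processes of the servers (indices `i.succ`)
    (T : Fin (c + 1) → ℤ → Ω → ℝ)
    (hT0 : MultiServer.IsStationaryRenewal P G (T 0))
    (hT : ∀ i : Fin c, MultiServer.IsStationaryRenewal P F (T i.succ))
    (hindep : iIndepFun (fun (i : Fin (c + 1)) ω (n : ℤ) => T i n ω) P) :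
    ∀ᵐ ω ∂P, ∀ τ : Fin (c + 1) → ℤ → ℝ, τ = (fun i n => T i n ω) →
      -- the vacation system is well defined
      (∀ t : ℝ, BddAbove ((fun s => MultiServer.netInput τ s t) '' Set.Iic t)) ∧
      (∀ n : ℤ, (MultiServer.delaySet τ n).Nonempty ∧
        ∃! i : Fin c, τ 0 n + MultiServer.delay τ n ∈ Set.range (τ i.succ)) ∧
      -- existence of the limits
      ∃ (W : ℤ → Fin c → ℝ) (Z : ℝ → ℕ × (Fin c → ℝ) × ℝ),
        (∀ n : ℤ, Tendsto
          (fun k : ℤ => MultiServer.KW (τ 0) (MultiServer.serviceTime τ) k n 0)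
          atBot (𝓝 (W n))) ∧
        (∀ t : ℝ, Tendsto
          (fun u : ℝ => MultiServer.stateFrom c (τ 0) (MultiServer.serviceTime τ) u (t - u))
          atBot (𝓝 (Z t))) ∧
        -- domination by the vacation system
        (∀ n : ℤ, W n ≤ MultiServer.vacKW τ n) ∧
        (∀ t : ℝ, ((Z t).1 : ℤ) ≤ MultiServer.vacQueue τ t) ∧
        -- sandwich
        (∀ k n : ℤ, k ≤ n → n ≤ -1 →
          MultiServer.KW (τ 0) (MultiServer.serviceTime τ) k n 0 ≤ W n ∧
          W n ≤ MultiServer.KW (τ 0) (MultiServer.serviceTime τ) k n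
            (MultiServer.vacKW τ k)) := by
  have : NeZero c := ⟨by omega⟩
  have hGi := MultiServer.integrable_id_of_rpow hG (by linarith) hGm
  have hFi := MultiServer.integrable_id_of_rpow hF (by linarith) hFm
  have hGpos := MultiServer.integral_id_pos hG hGi
  have hFpos := MultiServer.integral_id_pos hF hFi
  have hrenewal : ∀ i : Fin (c + 1), ∃ ν : Measure ℝ, Integrable (fun x : ℝ => x) ν ∧
      0 < ∫ x, x ∂ν ∧ MultiServer.IsStationaryRenewal P ν (T i) := fun i =>
    Fin.cases ⟨G, hGi, hGpos, hT0⟩ (fun i => ⟨F, hFi, hFpos, hT i⟩) i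
  choose ν hνi hνpos hren using hrenewal
  have hlf : ∀ᵐ ω ∂P, ∀ i, MultiServer.IsLocallyFinite fun n => T i n ω :=
    ae_all_iff.mpr fun i => (hren i).ae_isLocallyFinite (hνi i) (hνpos i)
  have hdisj : ∀ᵐ ω ∂P, ∀ i j, i ≠ j → ∀ m n, T i m ω ≠ T j n ω := by
    simp only [ae_all_iff]
    intro i j hij m n
    refine MultiServer.ae_ne_of_indepFun ((hren i).measurable m) ((hren j).measurable n)
      ((hindep.indepFun hij).comp (measurable_pi_apply m) (measurable_pi_apply n)) fun x => ?_
    filter_upwards [(hren j).ae_notMem_range (hνi j) (hνpos j) x] with ω hω h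
    exact hω ⟨n, h⟩
  filter_upwards [hlf, hdisj, hT0.tendsto_div hGi,
    ae_all_iff.mpr fun i => (hT i).tendsto_div hFi] with ω h1 h2 h3 h4
  rintro τ rfl
  exact MultiServer.IsStableInput.stationary_limits ⟨h1, h2,
    MultiServer.bddAbove_netInput hc hFpos hstab h1 h3.2 fun i => (h4 i).2⟩
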